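/- Let $(\Gamma,\gamma)$ be a spin network: $\Gamma$ is a finite cubic ribbon graph, i.e. a trivalent graph, possibly disconnected and possibly with loops and multiple edges, with a cyclic ordering of the three half-edges at each vertex, and $\gamma\colon E(\Gamma)\to\mathbb{N}$ is a decoration of its edges such that at every vertex $v$ the decorations $a_v,b_v,c_v$ of the three incident half-edges (a loop is counted twice) have even sum and satisfy $|a_v-b_v|\le c_v\le a_v+b_v$. Suppose that $\Gamma$ has no trivial components, i.e. no edges that close upon themselves without meeting any vertex. Thicken $\Gamma$ to an oriented surface, with vertices replaced by discs and edges by untwisted bands, as prescribed by the cyclic orderings. Put $\gamma(e)$ parallel strands on each edge $e$ and join them inside the disc of each vertex without crossings, so that $\frac{a_v+b_v-c_v}{2}$ strands join the edge decorated $a_v$ to the edge decorated $b_v$, and similarly for the other two pairs. Given a family $\sigma=(\sigma_e)_{e\in E(\Gamma)}$ with $\sigma_e\in\mathfrak{S}_{\gamma(e)}$, permute the strands on each edge $e$ by $\sigma_e$, and let $c(\sigma)$ be the number of closed curves obtained. The Penrose and the standard evaluations are $$\langle\Gamma,\gamma\rangle^P=\sum_{\sigma}\Bigl(\prod_{e\in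 E(\Gamma)}\operatorname{sgn}(\sigma_e)\Bigr)(-2)^{c(\sigma)},\qquad \langle\Gamma,\gamma\rangle^S=\langle\Gamma,\gamma\rangle^P\prod_{v\in V(\Gamma)}\left\{\left(\tfrac{a_v+b_v-c_v}{2}\right)!\left(\tfrac{a_v+c_v-b_v}{2}\right)!\left(\tfrac{b_v+c_v-a_v}{2}\right)!\right\}^{-1}.$$ Let the spectral radius $\rho_{\Gamma,\gamma}\in[0,\infty]$ be the inverse of the radius of convergence of the power series $\sum_{n=0}^{\infty}\langle\Gamma,n\gamma\rangle^S z^n$, where $n\gamma$ is the decoration $e\mapsto n\gamma(e)$. Then $$\rho_{\Gamma,\gamma}\le\prod_{v\in V(\Gamma)}\sqrt{\beta(a_v,b_v,c_v)},$$ where, with the convention $0^0=1$, $$\beta(a,b,c)=\frac{\left(\frac{a+b+c}{2}\right)^{\frac{a+b+c}{2}}}{\left(\frac{a+b-c}{2}\right)^{\frac{a+b-c}{2}}\left(\frac{a+c-b}{2}\right)^{\frac{a+c-b}{2}}\left(\frac{b+c-a}{2}\right)^{\frac{b+c-a}{2}}}.$$ -/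

import Mathlib

/-- A cubic ribbon graph with vertex set `V` and edge set `E`; loops, multiple edges,
several connected components and trivial components are allowed.  The two ends of an edge `e`
are `(e, false)` and `(e, true)`.  `halfEdge (v, 0)`, `halfEdge (v, 1)`, `halfEdge (v, 2)` are
the three ends of edges attached to the vertex `v`, listed in the (counterclockwise) cyclic
order at `v`.  Every end of an edge is attached at most once, and if one end of an edge is
attached to a vertex then so is the other one.  An edge none of whose ends is attached to a
vertex closes upon itself: it is a trivial component. -/
structure CubicRibbonGraph (V E : Type*) where
  halfEdge : V × Fin 3 → E × Bool
  halfEdge_injective : Function.Injective halfEdge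
  other_end_attached : ∀ e b, (e, b) ∈ Set.range halfEdge → (e, !b) ∈ Set.range halfEdge

namespace CubicRibbonGraph

variable {V E : Type*} (G : CubicRibbonGraph V E) (γ : E → ℕ)

/-- The edge `e` closes upon itself without meeting any vertex. -/
def IsTrivialComponent (e : E) : Prop :=
  ∀ b, (e, b) ∉ Set.range G.halfEdge

/-- The decoration of the `k`-th half-edge at `v`.  An edge which is a loop at `v` is seen by
two values of `k`. -/
def label (v : V) (k : Fin 3) : ℕ :=
  γ (G.halfEdge (v, k)).1

/-- Admissibility: at each vertex the three decorations have even sum and satisfy the triangle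
inequality `|a - b| ≤ c ≤ a + b`. -/
def Admissible : Prop :=
  ∀ v, Even (G.label γ v 0 + G.label γ v 1 + G.label γ v 2) ∧
    |(G.label γ v 0 : ℤ) - G.label γ v 1| ≤ G.label γ v 2 ∧
    (G.label γ v 2 : ℤ) ≤ G.label γ v 0 + G.label γ v 1

/-- The number `(a + b - c) / 2` of strands joining, at the vertex `v`, the `k`-th half-edge to
the next one in cyclic order, where `a`, `b`, `c` are the decorations of the `k`-th half-edge, of
the next one and of the remaining one.  For admissible decorations neither the subtraction nor
the division is truncated. -/
def corner (v : V) (k : Fin 3) : ℕ :=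
  (G.label γ v k + G.label γ v (k + 1) - G.label γ v (k + 2)) / 2

/-- Ends of strands.  An edge decorated by `a` carries `a` parallel strands.  At each of its two
ends they are numbered `0, …, a - 1` counterclockwise around the disc of the vertex to which
this end is attached. -/
abbrev StrandEnd : Type _ :=
  Σ h : E × Bool, Fin (γ h.1)

/-- Elementary connections between ends of strands in the state given by a family `σ` of
permutations, one for each edge (one for each Penrose bar).

* `vertex`: in the disc of a vertex, for each `k` the last `corner` strands of the `k`-th
  half-edge are connected to the first `corner` strands of the next half-edge, without crossings
  (so in reverse order).
* `edge`: along the band of an edge, strand `i` is permuted to position `σ i`.  The band is not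
  twisted and the two ends are both numbered counterclockwise, so that position `j` at one end
  faces position `a - 1 - j` at the other one.
* `closing`: the two ends of the band of a trivial component are glued to each other. -/
inductive Connected (σ : ∀ e, Equiv.Perm (Fin (γ e))) : StrandEnd γ → StrandEnd γ → Prop
  | vertex (v : V) (k : Fin 3) (p : Fin (γ (G.halfEdge (v, k)).1))
      (q : Fin (γ (G.halfEdge (v, k + 1)).1))
      (hpq : (p : ℕ) + q + 1 = G.label γ v k) (hq : (q : ℕ) < G.corner γ v k) :
      Connected σ ⟨G.halfEdge (v, k), p⟩ ⟨G.halfEdge (v, k + 1), q⟩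
  | edge (e : E) (i : Fin (γ e)) :
      Connected σ ⟨(e, false), i⟩ ⟨(e, true), (σ e i).rev⟩
  | closing (e : E) (he : G.IsTrivialComponent e) (i : Fin (γ e)) :
      Connected σ ⟨(e, true), i⟩ ⟨(e, false), i.rev⟩

/-- The number of closed curves in the state `σ`: the number of classes of the equivalence
relation on the ends of strands generated by the elementary connections. -/
noncomputable def numCurves (σ : ∀ e, Equiv.Perm (Fin (γ e))) : ℕ :=
  Nat.card (Quot (G.Connected γ σ))

/-- The Penrose evaluation: the sum over all states `σ` of `(-1)` to the number of crossings
(that is, the product of the signatures of the permutations) times `(-2)` to the number of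
closed curves. -/
noncomputable def penroseEval [Fintype E] [DecidableEq E] : ℤ :=
  ∑ σ : (∀ e, Equiv.Perm (Fin (γ e))),
    (∏ e, (Equiv.Perm.sign (σ e) : ℤ)) * (-2) ^ G.numCurves γ σ

/-- The standard evaluation: the Penrose evaluation divided by
`((a + b - c) / 2)! ((a + c - b) / 2)! ((b + c - a) / 2)!` for every vertex. -/
noncomputable def standardEval [Fintype V] [Fintype E] [DecidableEq E] : ℝ :=
  (G.penroseEval γ : ℝ) *
    ∏ v, ((Nat.factorial (G.corner γ v 0) * Nat.factorial (G.corner γ v 1) *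
      Nat.factorial (G.corner γ v 2) : ℕ) : ℝ)⁻¹

/-- The spectral radius, in `[0, ∞]`: the inverse of the radius of convergence of the power series
`∑ n, ⟨Γ, nγ⟩^S z ^ n`. -/
noncomputable def spectralRadius [Fintype V] [Fintype E] [DecidableEq E] : ENNReal :=
  (FormalMultilinearSeries.ofScalars ℝ
    (fun n : ℕ => G.standardEval (fun e => n * γ e))).radius⁻¹

end CubicRibbonGraph

/-- `β(a, b, c)`; the real power satisfies the convention `0 ^ 0 = 1`. -/
noncomputable def spinBeta (a b c : ℝ) : ℝ :=
  ((a + b + c) / 2) ^ ((a + b + c) / 2) /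
    (((a + b - c) / 2) ^ ((a + b - c) / 2) *
      ((a + c - b) / 2) ^ ((a + c - b) / 2) *
      ((b + c - a) / 2) ^ ((b + c - a) / 2))

/-! Give each strand end a spin, opposite at the two ends of every arc, whether the arc lies in a
vertex disc or on an edge. A closed curve carries exactly two such assignments, and all assignments
yield the same sign. Hence the crossing sign times `(-2) ^ c` is, up to a global sign, a sum over
spins (`sign_mul_pow_card_quot`). Summing over the permutations first turns the Penrose evaluation
into a contraction over the numbers `M h` of up spins at the half-edges (`abs_penroseEval`). An edge
decorated `a` contributes `±m! (a - m)!` or `0`. The vertices contribute the coefficient of `∏ x_h ^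
M h * y_h ^ (γ h.1 - M h)` in a product of powers of 2×2 minors (`sum_eps_mul_prod`).

That coefficient is bounded by Cauchy's estimate with `|x_h|² = M h` and `|y_h|² = γ h.1 - M h`.
These radii satisfy `|x_h|² + |y_h|² = γ h.1`, so Lagrange's inequality and weighted AM-GM bound the
polynomial of a vertex with corners `c k` and `J = ∑ c k` by `√(J ^ J * ∏ c k ^ c k)`, whatever `M`
is (`prod_norm_cross_pow_le`). By Stirling, the monomial at these radii cancels the edge weights up
to exponentials and polynomial factors.

Dividing by the factorials `(c k)!` cancels the exponentials and leaves `√β` at each vertex. There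
are polynomially many `M`, and replacing `γ` by `n * γ` raises `√β` to the power `n`; polynomial
factors do not change the radius of convergence. -/

/-! ### Sign and number of orbits of a permutation -/

open Equiv in
theorem Equiv.Perm.sameCycle_iff_eqvGen {Q : Type*} [Finite Q] (π : Perm Q) (x y : Q) :
    π.SameCycle x y ↔ Relation.EqvGen (fun a b => π a = b) x y := by
  constructor
  · rintro h
    obtain ⟨n, rfl⟩ := h.exists_nat_pow_eq
    clear h
    induction n with
    | zero => exact .refl _
    | succ n ih => exact ih.trans _ _ _ (.rel _ _ (by rw [pow_succ', Perm.mul_apply]))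
  · intro h
    induction h with
    | rel a b h => exact ⟨1, by simpa using h⟩
    | refl a => exact .refl _ _
    | symm a b _ ih => exact ih.symm
    | trans a b c _ _ h1 h2 => exact h1.trans h2

open Equiv in
theorem Equiv.Perm.quot_mk_eq_iff_sameCycle {Q : Type*} [Finite Q] (π : Perm Q) (x y : Q) :
    Quot.mk (fun a b => π a = b) x = Quot.mk _ y ↔ π.SameCycle x y := by
  rw [Perm.sameCycle_iff_eqvGen, Quot.eq]

open Equiv in
/-- The orbits of a permutation are its fixed points and its nontrivial cycles. -/
theorem Equiv.Perm.card_quot {Q : Type*} [Fintype Q] [DecidableEq Q] (π : Perm Q) :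
    Nat.card (Quot (fun a b => π a = b)) + π.support.card =
      Fintype.card Q + π.cycleFactorsFinset.card := by
  let F : {x // x ∉ π.support} ⊕ {c // c ∈ π.cycleFactorsFinset} → Quot (fun a b => π a = b) :=
    Sum.elim (fun x => Quot.mk _ x.1)
      (fun c => Quot.mk _ (Perm.mem_cycleFactorsFinset_iff.mp c.2).1.nonempty_support.choose)
  have hspec : ∀ c (hc : c ∈ π.cycleFactorsFinset),
      (Perm.mem_cycleFactorsFinset_iff.mp hc).1.nonempty_support.choose ∈ c.support := fun c hc =>
    (Perm.mem_cycleFactorsFinset_iff.mp hc).1.nonempty_support.choose_spec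
  have hF : Function.Bijective F := by
    constructor
    · rintro (⟨x, hx⟩ | ⟨c, hc⟩) (⟨y, hy⟩ | ⟨d, hd⟩) h
      · simp only [F, Sum.elim_inl, Perm.quot_mk_eq_iff_sameCycle] at h
        have := h.eq_of_left (by simpa [Function.IsFixedPt] using hx)
        simp [this]
      · simp only [F, Sum.elim_inl, Sum.elim_inr, Perm.quot_mk_eq_iff_sameCycle] at h
        have h1 := h.eq_of_left (by simpa [Function.IsFixedPt] using hx)
        exact absurd (Perm.mem_cycleFactorsFinset_support_le hd (h1 ▸ hspec d hd)) hx
      · simp only [F, Sum.elim_inl, Sum.elim_inr, Perm.quot_mk_eq_iff_sameCycle] at h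
        have h1 := h.symm.eq_of_left (by simpa [Function.IsFixedPt] using hy)
        exact absurd (Perm.mem_cycleFactorsFinset_support_le hc (h1 ▸ hspec c hc)) hy
      · simp only [F, Sum.elim_inr, Perm.quot_mk_eq_iff_sameCycle] at h
        have h1 := Perm.cycle_is_cycleOf (hspec c hc) hc
        have h2 := Perm.cycle_is_cycleOf (hspec d hd) hd
        have : c = d := by rw [h1, h2, h.cycleOf_eq]
        simp [this]
    · intro z
      induction z using Quot.ind with | _ x =>
      by_cases hx : x ∈ π.support
      · have hc := Perm.cycleOf_mem_cycleFactorsFinset_iff.mpr hx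
        refine ⟨Sum.inr ⟨π.cycleOf x, hc⟩, ?_⟩
        simp only [F, Sum.elim_inr, Perm.quot_mk_eq_iff_sameCycle]
        have := hspec _ hc
        rw [Perm.mem_support_cycleOf_iff] at this
        exact this.1.symm
      · exact ⟨Sum.inl ⟨x, hx⟩, rfl⟩
  rw [← Nat.card_congr (Equiv.ofBijective F hF), Nat.card_sum]
  have h1 : Nat.card {x // x ∉ π.support} = Fintype.card Q - π.support.card := by
    rw [Nat.subtype_card π.supportᶜ (by simp), Finset.card_compl]
  have h2 : Nat.card {c // c ∈ π.cycleFactorsFinset} = π.cycleFactorsFinset.card := by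
    simp
  have h3 := Finset.card_le_univ π.support
  omega

-- A cycle of length `l` has sign `(-1) ^ (l + 1)`; fixed points count as orbits of length one and
-- contribute `1`.
open Equiv in
theorem Equiv.Perm.sign_eq_pow_card_quot {Q : Type*} [Fintype Q] [DecidableEq Q] (π : Perm Q) :
    (Perm.sign π : ℤ) = (-1) ^ (Fintype.card Q + Nat.card (Quot (fun a b => π a = b))) := by
  have h := π.card_quot
  have hc : Multiset.card π.cycleType = π.cycleFactorsFinset.card := by
    simp [Perm.cycleType_def]
  rw [Perm.sign_of_cycleType, Perm.sum_cycleType, hc]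
  push_cast
  set N := Nat.card (Quot (fun a b => π a = b))
  have e1 : ((-1 : ℤ)) ^ (π.support.card + π.cycleFactorsFinset.card)
      * (-1) ^ (Fintype.card Q + N) = 1 := by
    rw [← pow_add]
    apply Even.neg_one_pow
    use Fintype.card Q + π.cycleFactorsFinset.card
    omega
  have e2 : ((-1 : ℤ)) ^ (Fintype.card Q + N) * (-1) ^ (Fintype.card Q + N) = 1 := by
    rw [← pow_add]
    exact Even.neg_one_pow ⟨_, rfl⟩
  have e3 : ((-1 : ℤ)) ^ (Fintype.card Q + N) ≠ 0 := pow_ne_zero _ (by norm_num)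
  exact mul_right_cancel₀ e3 (e1.trans e2.symm)

/-! ### Closed curves from two systems of arcs, as a sum over spins -/

namespace StrandGluing

open Equiv

/-- The arcs `(q, false) — (q, true)` are glued with their images under `ψ`. -/
inductive Rel {Q : Type*} (ψ : Perm (Q × Bool)) : Q × Bool → Q × Bool → Prop
  | left (q : Q) : Rel ψ (q, false) (q, true)
  | right (q : Q) : Rel ψ (ψ (q, false)) (ψ (q, true))

/-- The spin at an end of an arc; the two ends of an arc have opposite spins. -/
def spin {Q : Type*} (f : Q → Bool) (x : Q × Bool) : Bool := xor (f x.1) x.2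

/-- The spins at the two ends of every image arc are opposite too. -/
def Compat {Q : Type*} (ψ : Perm (Q × Bool)) (f : Q → Bool) : Prop :=
  ∀ q, spin f (ψ (q, true)) = !spin f (ψ (q, false))

/-- The sign attached to a spin. -/
def eps (b : Bool) : ℤ := if b then -1 else 1

/-- The permutation `xor c` of `Bool`. -/
def xorPerm (c : Bool) : Perm Bool where
  toFun b := xor b c
  invFun b := xor b c
  left_inv b := by cases b <;> cases c <;> rfl
  right_inv b := by cases b <;> cases c <;> rfl

theorem sign_xorPerm (c : Bool) : (Perm.sign (xorPerm c) : ℤ) = eps c := by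
  cases c <;> decide

variable {Q : Type*} {ψ : Perm (Q × Bool)} {f : Q → Bool}

theorem Compat.spin_apply (hf : Compat ψ f) (q : Q) (b : Bool) :
    spin f (ψ (q, b)) = xor b (spin f (ψ (q, false))) := by
  cases b
  · simp
  · rw [hf q]; simp

/-- The permutation of the arc ends that makes all the spins at `(q, b)` equal to `b`. -/
def flip (g : Q → Bool) : Perm (Q × Bool) := prodCongrRight fun q => xorPerm (g q)

theorem flip_apply (g : Q → Bool) (x : Q × Bool) : flip g x = (x.1, xor x.2 (g x.1)) := rfl

theorem sign_flip [Fintype Q] [DecidableEq Q] (g : Q → Bool) :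
    (Perm.sign (flip g) : ℤ) = ∏ q, eps (g q) := by
  rw [flip, Perm.sign_prodCongrRight]
  push_cast
  exact Finset.prod_congr rfl fun q _ => sign_xorPerm _

theorem exists_eq_prodCongrLeft (τ : Perm (Q × Bool)) (h : ∀ x, (τ x).2 = x.2) :
    ∃ t : Bool → Perm Q, τ = prodCongrLeft t := by
  have h' : ∀ x, (τ.symm x).2 = x.2 := fun x => by
    rw [← h (τ.symm x), Equiv.apply_symm_apply]
  refine ⟨fun b => ⟨fun q => (τ (q, b)).1, fun q => (τ.symm (q, b)).1, fun q => ?_, fun q => ?_⟩, ?_⟩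
  · have : ((τ (q, b)).1, b) = τ (q, b) := Prod.ext rfl (h (q, b)).symm
    simp [this]
  · have : ((τ.symm (q, b)).1, b) = τ.symm (q, b) := Prod.ext rfl (h' (q, b)).symm
    simp [this]
  · ext1 x
    exact Prod.ext rfl (h x)

/-- Orient every arc from spin `false` to spin `true`. The reorientations `A` and `B` account for
the two products of `eps`. What remains of `ψ` preserves the `Bool` coordinate, so it is a pair of
permutations `t`, and the curves are the cycles of `t true * (t false)⁻¹`. -/
theorem Compat.sign_eq [Fintype Q] [DecidableEq Q] (hf : Compat ψ f) :
    (Perm.sign ψ : ℤ) = (-1) ^ (Fintype.card Q + Nat.card (Quot (Rel ψ))) *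
      ((∏ q, eps (f q)) * ∏ q, eps (spin f (ψ (q, false)))) := by
  set A := flip f
  set B := flip fun q => spin f (ψ (q, false))
  have hA : ∀ x, spin f (A x) = x.2 := fun x => by
    rw [show A x = (x.1, xor x.2 (f x.1)) from rfl, spin]
    cases f x.1 <;> simp
  have hB : ∀ x, spin f (ψ (B x)) = x.2 := fun x => by
    rw [show B x = (x.1, xor x.2 (spin f (ψ (x.1, false)))) from rfl, hf.spin_apply]
    simp
  obtain ⟨t, ht⟩ := exists_eq_prodCongrLeft (A⁻¹ * ψ * B) fun x => by
    rw [← hA, Perm.mul_apply, Perm.mul_apply, show A (A⁻¹ (ψ (B x))) = ψ (B x) from A.apply_symm_apply _, hB]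
  have hψ : ψ = A * prodCongrLeft t * B⁻¹ := by rw [← ht]; group
  have hfst : ∀ q b, (ψ (B (q, b))).1 = t b q := fun q b => by
    rw [hψ]; simp [A, flip_apply, Perm.mul_apply]
  have hAB : ∀ q b, B (q, b) = (q, b) ∨ B (q, b) = (q, !b) := fun q b => by
    cases h : spin f (ψ (q, false)) <;> simp [B, flip_apply, h]
  have hmk : ∀ x : Q × Bool, Quot.mk (Rel ψ) x = Quot.mk (Rel ψ) (x.1, false) := by
    rintro ⟨q, b⟩
    cases b
    · rfl
    · exact (Quot.sound (.left q)).symm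
  have hmk' : ∀ q b b', Quot.mk (Rel ψ) (ψ (q, b)) = Quot.mk (Rel ψ) (ψ (q, b')) := by
    intro q b b'
    have := Quot.sound (Rel.right (ψ := ψ) q)
    cases b <;> cases b' <;> simp [this]
  let π : Perm Q := t true * (t false)⁻¹
  let e : Quot (Rel ψ) ≃ Quot (fun a b => π a = b) :=
    { toFun := Quot.lift (fun x => Quot.mk _ x.1) (by
        have key : ∀ q, Quot.mk (fun a b => π a = b) (t false q) = Quot.mk _ (t true q) :=
          fun q => Quot.sound (by simp [π])
        intro x y hxy
        cases hxy with
        | left q => rfl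
        | right q =>
          have h0 := hfst q false
          have h1 := hfst q true
          cases h : spin f (ψ (q, false))
          · simp only [B, flip_apply, h, Bool.xor_false] at h0 h1
            simp only [h0, h1, key]
          · simp only [B, flip_apply, h, Bool.xor_true, Bool.not_true, Bool.not_false] at h0 h1
            simp only [h0, h1, key])
      invFun := Quot.lift (fun q => Quot.mk _ (q, false)) (by
        intro x y hxy
        obtain ⟨q, rfl⟩ := (t false).surjective x
        have : y = t true q := by simpa [π] using hxy.symm
        rw [this, ← hfst, ← hfst, ← hmk, ← hmk]
        exact hmk' q _ _)
      left_inv := by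
        intro x
        induction x using Quot.ind with | _ x => exact (hmk x).symm
      right_inv := by
        intro x
        induction x using Quot.ind with | _ x => rfl }
  have hs : Perm.sign ψ = Perm.sign A * Perm.sign π * Perm.sign B := by
    rw [hψ]
    simp only [Perm.sign_mul, Perm.sign_inv, Perm.sign_prodCongrLeft, Fintype.prod_bool, π]
  rw [Nat.card_congr e, ← Perm.sign_eq_pow_card_quot, hs, ← sign_flip, ← sign_flip]
  push_cast
  ring

/-- Let `α` and `β` exchange the ends of the arcs of the two systems. They generate a dihedral
action in which each closed curve splits into two cycles of `κ = β * α`, exchanged by `α`. Spins are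
constant on these cycles and distinguish the two. -/
theorem exists_compat [Finite Q] (ψ : Perm (Q × Bool)) : ∃ f, Compat ψ f := by
  classical
  let α : Perm (Q × Bool) := flip fun _ => true
  let β : Perm (Q × Bool) := ψ * α * ψ⁻¹
  have hα : ∀ x, α x = (x.1, !x.2) := fun x => by simp [α, flip_apply]
  have hα2 : α⁻¹ = α := by
    rw [inv_eq_iff_mul_eq_one]; ext1 x; simp [hα]
  have hβ2 : β⁻¹ = β := by
    simp only [β, mul_inv_rev, inv_inv, hα2, mul_assoc]
  have hαne : ∀ x, α x ≠ x := fun x h => by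
    have := congrArg Prod.snd h
    simp [hα] at this
  have hβne : ∀ x, β x ≠ x := fun x h => by
    apply hαne (ψ⁻¹ x)
    have : ψ (α (ψ⁻¹ x)) = x := h
    rw [Perm.eq_inv_iff_eq, this]
  set κ := β * α
  have hαα : ∀ x, α (α x) = x := fun x => by
    conv_lhs => enter [1]; rw [← hα2]
    simp
  have hconj : ∀ n : ℤ, α * κ ^ n = κ ^ (-n) * α := fun n => by
    have h0 : α * κ * α⁻¹ = κ⁻¹ := by
      simp only [κ, mul_inv_rev, hβ2, hα2]
      rw [mul_assoc, mul_assoc, show α * α = 1 from mul_eq_one_iff_eq_inv.mpr hα2.symm, mul_one]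
    rw [← mul_inv_eq_iff_eq_mul, ← conj_zpow, h0, inv_zpow']
  -- If `κ ^ n` sends `x` to `α x`, the midpoint of the path is a fixed point of `α` for even `n`
  -- and of `β` for odd `n`; neither involution has one.
  have hodd : ∀ x, ¬ κ.SameCycle x (α x) := by
    rintro x ⟨n, hn⟩
    rcases Int.even_or_odd' n with ⟨j, rfl | rfl⟩
    · apply hαne ((κ ^ j) x)
      have : (κ ^ (-j)) ((κ ^ (2 * j)) x) = (κ ^ (-j)) (α x) := by rw [hn]
      rw [← Perm.mul_apply, ← Perm.mul_apply, ← hconj, ← zpow_add] at this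
      rw [← Perm.mul_apply, ← this]
      congr 2; ring
    · apply hβne (α ((κ ^ j) x))
      have : (κ ^ (-j)) ((κ ^ (2 * j + 1)) x) = (κ ^ (-j)) (α x) := by rw [hn]
      rw [← Perm.mul_apply, ← Perm.mul_apply, ← hconj, ← zpow_add] at this
      have h2 : β (α ((κ ^ j) x)) = (κ ^ (1 + j)) x := by rw [zpow_one_add]; rfl
      rw [h2, ← Perm.mul_apply α, ← this]
      congr 2; ring
  have hαβ : ∀ x, κ (α x) = β x := fun x => by simp only [κ, Perm.mul_apply, hαα]
  have hsame : ∀ x y, κ.SameCycle x y → κ.SameCycle (α x) (α y) := by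
    rintro x y ⟨n, rfl⟩
    refine ⟨-n, ?_⟩
    rw [← Perm.mul_apply, ← Perm.mul_apply, hconj]
  have hβrel : ∀ q, β (ψ (q, false)) = ψ (q, true) := fun q => by
    simp [β, hα]
  let r : Q × Bool → Q × Bool := fun x => (Quot.mk (Rel ψ) x).out
  have hr : ∀ x, κ.SameCycle (r x) x ∨ κ.SameCycle (r x) (α x) := by
    intro x
    have h : Relation.EqvGen (Rel ψ) (r x) x := Quot.eq.mp (Quot.out_eq _)
    generalize r x = y at h
    have hstep : ∀ a b, Rel ψ a b → κ.SameCycle a (α b) := by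
      intro a b hab
      cases hab with
      | left q => rw [hα]; exact .refl _ _
      | right q =>
        rw [← hβrel]
        refine Perm.SameCycle.symm ⟨1, ?_⟩
        rw [zpow_one, hαβ, ← Perm.mul_apply]
        nth_rw 1 [← hβ2]
        simp
    induction h with
    | rel a b h => exact .inr (hstep a b h)
    | refl a => exact .inl (.refl _ _)
    | symm a b _ ih =>
      rcases ih with h | h
      · exact .inl h.symm
      · right
        have := hsame _ _ h
        rw [hαα] at this
        exact this.symm
    | trans a b c _ _ h1 h2 =>
      rcases h1 with h1 | h1 <;> rcases h2 with h2 | h2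
      · exact .inl (h1.trans h2)
      · exact .inr (h1.trans h2)
      · exact .inr (h1.trans (hsame _ _ h2))
      · left
        have := hsame _ _ h2
        rw [hαα] at this
        exact h1.trans this
  let s : Q × Bool → Bool := fun x => decide (κ.SameCycle (r x) x)
  have hsα : ∀ x y, r x = r y → κ.SameCycle x (α y) → s x = !s y := by
    intro x y hxy h
    by_cases hx : κ.SameCycle (r x) x
    · have hy : ¬ κ.SameCycle (r y) y := fun hy => by
        rw [hxy] at hx
        exact hodd y ((hy.symm.trans hx).trans h)
      simp [s, hx, hy]
    · have hy : κ.SameCycle (r y) y := by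
        have h1 := (hr x).resolve_left hx
        have h2 := hsame _ _ h
        rw [hαα] at h2
        rw [← hxy]
        exact h1.trans h2
      simp [s, hx, hy]
  have hs1 : ∀ q, s (q, true) = !s (q, false) := fun q => by
    apply hsα
    · simp only [r, Quot.sound (Rel.left (ψ := ψ) q)]
    · rw [hα]; exact .refl _ _
  have hs2 : ∀ q, s (ψ (q, true)) = !s (ψ (q, false)) := fun q => by
    apply hsα
    · simp only [r, Quot.sound (Rel.right (ψ := ψ) q)]
    · rw [← hβrel, ← hαβ]
      exact Perm.SameCycle.symm ⟨1, by simp⟩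
  have hspin : spin (fun q => s (q, false)) = s := by
    funext x
    obtain ⟨q, b⟩ := x
    cases b <;> simp [spin, hs1]
  exact ⟨fun q => s (q, false), fun q => by rw [hspin]; exact hs2 q⟩

instance [Fintype Q] : DecidablePred (Compat ψ) :=
  fun _ => inferInstanceAs (Decidable (∀ _, _))

/-- The `xor` of two compatible assignments is constant along each curve, so after fixing one of
them, `g`, the others correspond to one free bit per curve. -/
theorem card_compat [Fintype Q] [DecidableEq Q] (ψ : Perm (Q × Bool)) :
    Fintype.card {f // Compat ψ f} = 2 ^ Nat.card (Quot (Rel ψ)) := by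
  classical
  obtain ⟨g, hg⟩ := exists_compat ψ
  have := Fintype.ofFinite (Quot (Rel ψ))
  let e : {f // Compat ψ f} ≃ (Quot (Rel ψ) → Bool) :=
    { toFun := fun f => Quot.lift (fun x => xor (spin f.1 x) (spin g x)) (by
        intro x y hxy
        cases hxy with
        | left q => simp [spin]
        | right q => rw [f.2 q, hg q]; simp)
      invFun := fun u => ⟨fun q => xor (u (Quot.mk _ (q, false))) (g q), by
        have h : ∀ x, spin (fun q => xor (u (Quot.mk (Rel ψ) (q, false))) (g q)) x =
            xor (u (Quot.mk _ x)) (spin g x) := by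
          rintro ⟨q, b⟩
          cases b
          · simp [spin]
          · rw [← Quot.sound (Rel.left (ψ := ψ) q)]; simp [spin]
        intro q
        rw [h, h, hg, Quot.sound (Rel.right (ψ := ψ) q)]
        simp⟩
      left_inv := fun f => by ext1; funext q; simp [spin]
      right_inv := fun u => by
        funext x
        induction x using Quot.ind with | _ x =>
        obtain ⟨q, b⟩ := x
        cases b
        · simp [spin]
        · rw [← Quot.sound (Rel.left (ψ := ψ) q)]; simp [spin] }
  rw [Fintype.card_congr e, Fintype.card_fun, Fintype.card_bool, Nat.card_eq_fintype_card]

/-- The state sum of two systems of arcs: `-2` to the number of closed curves is, up to sign, a sum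
over spins. -/
theorem sign_mul_pow_card_quot [Fintype Q] [DecidableEq Q] (ψ : Perm (Q × Bool)) :
    (Perm.sign ψ : ℤ) * (-2) ^ Nat.card (Quot (Rel ψ)) = (-1) ^ Fintype.card Q *
      ∑ f with Compat ψ f, (∏ q, eps (f q)) * ∏ q, eps (spin f (ψ (q, false))) := by
  -- All compatible summands are equal; their number supplies `2 ^ c` and their common sign supplies
  -- `(-1) ^ c`.
  have h : ∀ f ∈ Finset.univ.filter (Compat ψ),
      (∏ q, eps (f q)) * ∏ q, eps (spin f (ψ (q, false))) =
        (Perm.sign ψ : ℤ) * (-1) ^ (Fintype.card Q + Nat.card (Quot (Rel ψ))) := by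
    intro f hf
    have h0 : ((-1 : ℤ)) ^ (Fintype.card Q + Nat.card (Quot (Rel ψ))) *
        (-1) ^ (Fintype.card Q + Nat.card (Quot (Rel ψ))) = 1 := by
      rw [← pow_add, Even.neg_one_pow ⟨_, rfl⟩]
    rw [(Finset.mem_filter.mp hf).2.sign_eq]
    linear_combination (-((∏ q, eps (f q)) * ∏ q, eps (spin f (ψ (q, false))))) * h0
  rw [Finset.sum_congr rfl h, Finset.sum_const, nsmul_eq_mul, ← Fintype.card_subtype,
    card_compat, pow_add]
  have h1 : ((-1 : ℤ)) ^ Fintype.card Q * (-1) ^ Fintype.card Q = 1 := by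
    rw [← pow_add, Even.neg_one_pow ⟨_, rfl⟩]
  rw [show (-2 : ℤ) = 2 * -1 by norm_num, mul_pow]
  push_cast
  linear_combination (-(Perm.sign ψ : ℤ) * 2 ^ Nat.card (Quot (Rel ψ)) *
    (-1) ^ Nat.card (Quot (Rel ψ))) * h1

end StrandGluing

/-! ### Analytic estimates and a count of permutations -/

namespace SpinNetworkBounds

/-- Orthogonality of characters; both exponents lie below `N`, so distinct ones are distinct modulo
`N`. -/
theorem sum_range_pow_mul_inv_pow {N : ℕ} {ζ : ℂ} (hζ : IsPrimitiveRoot ζ N) {k m : ℕ}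
    (hk : k < N) (hm : m < N) :
    ∑ t : Fin N, (ζ ^ (t : ℕ)) ^ k * ((ζ ^ (t : ℕ)) ^ m)⁻¹ = if k = m then (N : ℂ) else 0 := by
  have hζ0 : ζ ≠ 0 := hζ.ne_zero (by omega)
  split_ifs with h
  · subst h
    rw [Finset.sum_congr rfl fun t _ => mul_inv_cancel₀ (pow_ne_zero _ (pow_ne_zero _ hζ0))]
    simp
  · set x := ζ ^ k * (ζ ^ m)⁻¹ with hx
    have hx1 : x ≠ 1 := fun h1 => h <| hζ.pow_inj hk hm <| by
      rwa [hx, mul_inv_eq_one₀ (pow_ne_zero _ hζ0)] at h1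
    have hxN : x ^ N = 1 := by
      rw [hx, mul_pow, inv_pow, ← pow_mul, ← pow_mul, mul_comm k, mul_comm m, pow_mul, pow_mul,
        hζ.pow_eq_one]
      simp
    have h2 : ∀ t : Fin N, (ζ ^ (t : ℕ)) ^ k * ((ζ ^ (t : ℕ)) ^ m)⁻¹ = x ^ (t : ℕ) := fun t => by
      rw [hx, mul_pow, inv_pow, ← pow_mul, ← pow_mul, ← pow_mul, ← pow_mul, mul_comm k,
        mul_comm m]
    rw [Finset.sum_congr rfl fun t _ => h2 t, Fin.sum_univ_eq_sum_range (fun t => x ^ t)]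
    have h3 := mul_geom_sum x N
    rw [hxN, sub_self] at h3
    exact (mul_eq_zero.mp h3).resolve_left (sub_ne_zero.mpr hx1)

/-- Cauchy's estimate for the coefficients of a polynomial in several variables, bounded on the
unit torus. -/
theorem norm_sum_filter_le {ι F : Type*} [Fintype ι] [DecidableEq ι] [Fintype F]
    (a : F → ℂ) (e : F → ι → ℕ) (M : ι → ℕ) (B : ℝ)
    (hB : ∀ z : ι → ℂ, (∀ i, ‖z i‖ = 1) → ‖∑ f, a f * ∏ i, z i ^ e f i‖ ≤ B) :
    ‖∑ f with e f = M, a f‖ ≤ B := by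
  -- `N` exceeds every exponent, so averaging over the `N`-th roots of unity extracts the
  -- coefficient exactly and replaces the Cauchy integral.
  set N : ℕ := 1 + ∑ f, ∑ i, e f i + ∑ i, M i with hN
  have hN0 : N ≠ 0 := by omega
  have he : ∀ f i, e f i < N := fun f i => by
    have h1 := Finset.single_le_sum (f := fun i => e f i) (fun _ _ => Nat.zero_le _)
      (Finset.mem_univ i)
    have h2 := Finset.single_le_sum (f := fun f => ∑ i, e f i) (fun _ _ => Nat.zero_le _)
      (Finset.mem_univ f)
    omega
  have hM : ∀ i, M i < N := fun i => by
    have h1 := Finset.single_le_sum (f := fun i => M i) (fun _ _ => Nat.zero_le _)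
      (Finset.mem_univ i)
    omega
  have hζ := Complex.isPrimitiveRoot_exp N hN0
  set ζ := Complex.exp (2 * Real.pi * Complex.I / N)
  have hζ1 : ‖ζ‖ = 1 := hζ.norm'_eq_one hN0
  have key : ∑ t : ι → Fin N, (∏ i, ((ζ ^ (t i : ℕ)) ^ M i)⁻¹) *
      (∑ f, a f * ∏ i, (ζ ^ (t i : ℕ)) ^ e f i) =
      (N : ℂ) ^ Fintype.card ι * ∑ f with e f = M, a f := by
    simp_rw [Finset.mul_sum]
    rw [Finset.sum_comm, Finset.sum_filter]
    refine Finset.sum_congr rfl fun f _ => ?_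
    have h1 : ∀ t : ι → Fin N, (∏ i, ((ζ ^ (t i : ℕ)) ^ M i)⁻¹) *
        (a f * ∏ i, (ζ ^ (t i : ℕ)) ^ e f i) =
        a f * ∏ i, ((ζ ^ (t i : ℕ)) ^ e f i * ((ζ ^ (t i : ℕ)) ^ M i)⁻¹) := fun t => by
      rw [Finset.prod_mul_distrib]; ring
    rw [Finset.sum_congr rfl fun t _ => h1 t, ← Finset.mul_sum,
      ← Fintype.prod_sum (fun i (t : Fin N) => (ζ ^ (t : ℕ)) ^ e f i * ((ζ ^ (t : ℕ)) ^ M i)⁻¹)]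
    rw [Finset.prod_congr rfl fun i _ => sum_range_pow_mul_inv_pow hζ (he f i) (hM i)]
    split_ifs with h
    · simp [h, mul_comm]
    · obtain ⟨i, hi⟩ := Function.ne_iff.mp h
      rw [Finset.prod_eq_zero (Finset.mem_univ i) (if_neg hi)]
      simp
  have h2 : ‖∑ t : ι → Fin N, (∏ i, ((ζ ^ (t i : ℕ)) ^ M i)⁻¹) *
      (∑ f, a f * ∏ i, (ζ ^ (t i : ℕ)) ^ e f i)‖ ≤ (N : ℝ) ^ Fintype.card ι * B := by
    refine (norm_sum_le _ _).trans ?_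
    have h3 : ∀ t ∈ (Finset.univ : Finset (ι → Fin N)), ‖(∏ i, ((ζ ^ (t i : ℕ)) ^ M i)⁻¹) *
        (∑ f, a f * ∏ i, (ζ ^ (t i : ℕ)) ^ e f i)‖ ≤ B := fun t _ => by
      rw [norm_mul, norm_prod]
      simp only [norm_inv, norm_pow, hζ1, one_pow, inv_one, Finset.prod_const_one, one_mul]
      exact hB (fun i => ζ ^ (t i : ℕ)) (fun i => by simp [hζ1])
    refine (Finset.sum_le_card_nsmul _ _ _ h3).trans_eq ?_
    simp
  rw [key, norm_mul, norm_pow, Complex.norm_natCast] at h2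
  exact le_of_mul_le_mul_left h2 (by positivity)

/-- Lagrange's inequality for the cross product of two complex vectors. -/
theorem sum_norm_cross_sq_le (x y : Fin 3 → ℂ) :
    ∑ k, ‖x k * y (k + 1) - y k * x (k + 1)‖ ^ 2 ≤ (∑ k, ‖x k‖ ^ 2) * ∑ k, ‖y k‖ ^ 2 := by
  have h : (∑ k, ‖x k‖ ^ 2) * (∑ k, ‖y k‖ ^ 2) -
      ∑ k, ‖x k * y (k + 1) - y k * x (k + 1)‖ ^ 2 =
      ‖∑ k, x k * (starRingEnd ℂ) (y k)‖ ^ 2 := by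
    simp only [Fin.sum_univ_three, ← Complex.normSq_eq_norm_sq, Complex.normSq_apply,
      Complex.add_re, Complex.add_im, Complex.sub_re, Complex.sub_im, Complex.mul_re,
      Complex.mul_im, Complex.conj_re, Complex.conj_im, Fin.reduceAdd]
    ring
  nlinarith [sq_nonneg ‖∑ k, x k * (starRingEnd ℂ) (y k)‖]

/-- Weighted AM-GM for the numbers `s i / c i` with weights `c i`, cleared of denominators so that
vanishing weights are allowed. -/
theorem prod_pow_mul_le {ι : Type*} [Fintype ι] (c : ι → ℕ) (s : ι → ℝ) (hs : ∀ i, 0 ≤ s i) :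
    (∏ i, s i ^ c i) * ((∑ i, c i : ℕ) : ℝ) ^ (∑ i, c i) ≤
      (∏ i, (c i : ℝ) ^ c i) * (∑ i, s i) ^ (∑ i, c i) := by
  set J := ∑ i, c i with hJ
  rcases Nat.eq_zero_or_pos J with h0 | h0
  · have : ∀ i, c i = 0 := fun i => (Finset.sum_eq_zero_iff.mp (hJ ▸ h0)) i (Finset.mem_univ i)
    simp [h0, this]
  have hJR : (0 : ℝ) < J := by exact_mod_cast h0
  have hsum : ∑ i, (c i : ℝ) = J := by rw [hJ]; push_cast; rfl
  have h1 := Real.geom_mean_le_arith_mean Finset.univ (fun i => (c i : ℝ)) (fun i => s i / c i)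
    (fun i _ => by positivity) (by rw [hsum]; exact hJR)
    (fun i _ => div_nonneg (hs i) (by positivity))
  rw [hsum] at h1
  simp only [Real.rpow_natCast] at h1
  have hP : 0 ≤ ∏ i, (s i / c i) ^ c i :=
    Finset.prod_nonneg fun i _ => pow_nonneg (div_nonneg (hs i) (by positivity)) _
  -- Only an inequality: terms with `c i = 0` are lost on the left.
  have h2 : ∑ i, (c i : ℝ) * (s i / c i) ≤ ∑ i, s i := by
    refine Finset.sum_le_sum fun i _ => ?_
    rcases eq_or_ne (c i : ℝ) 0 with h | h
    · rw [h]; simpa using hs i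
    · rw [mul_div_cancel₀ _ h]
  have h3 : ∏ i, (s i / c i) ^ c i ≤ ((∑ i, s i) / J) ^ J := by
    have h4 := pow_le_pow_left₀ (Real.rpow_nonneg hP _)
      (h1.trans (div_le_div_of_nonneg_right h2 hJR.le)) J
    rwa [Real.rpow_inv_natCast_pow hP h0.ne'] at h4
  have h5 : ∏ i, s i ^ c i = (∏ i, (c i : ℝ) ^ c i) * ∏ i, (s i / c i) ^ c i := by
    rw [← Finset.prod_mul_distrib]
    refine Finset.prod_congr rfl fun i _ => ?_
    rcases Nat.eq_zero_or_pos (c i) with h | h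
    · simp [h]
    · rw [← mul_pow, mul_div_cancel₀]
      exact_mod_cast h.ne'
  rw [h5, mul_assoc]
  refine mul_le_mul_of_nonneg_left ?_ (Finset.prod_nonneg fun i _ => by positivity)
  rw [div_pow, le_div_iff₀ (by positivity)] at h3
  exact h3

/-- The maximum of the generating polynomial of a vertex. -/
theorem prod_norm_cross_pow_le (c : Fin 3 → ℕ) (x y : Fin 3 → ℂ)
    (h : ∑ k, (‖x k‖ ^ 2 + ‖y k‖ ^ 2) = 2 * ((∑ k, c k : ℕ) : ℝ)) :
    ∏ k, ‖x k * y (k + 1) - y k * x (k + 1)‖ ^ c k ≤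
      √((∏ k, (c k : ℝ) ^ c k) * ((∑ k, c k : ℕ) : ℝ) ^ (∑ k, c k)) := by
  set J := ∑ k, c k with hJ
  apply Real.le_sqrt_of_sq_le
  rw [Finset.sum_add_distrib] at h
  have h1 := prod_pow_mul_le c (fun k => ‖x k * y (k + 1) - y k * x (k + 1)‖ ^ 2)
    (fun k => by positivity)
  have hC : 0 ≤ ∏ k, (c k : ℝ) ^ c k := Finset.prod_nonneg fun i _ => by positivity
  -- The squared norms of `x` and `y` add up to `2 * J`, so their product is at most `J ^ 2`.
  have h2 : ∑ k, ‖x k * y (k + 1) - y k * x (k + 1)‖ ^ 2 ≤ (J : ℝ) ^ 2 := by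
    refine (sum_norm_cross_sq_le x y).trans ?_
    nlinarith [sq_nonneg ((∑ k, ‖x k‖ ^ 2) - ∑ k, ‖y k‖ ^ 2)]
  have h3 : (∑ k, ‖x k * y (k + 1) - y k * x (k + 1)‖ ^ 2) ^ J ≤ (J : ℝ) ^ J * (J : ℝ) ^ J := by
    rw [← mul_pow, ← sq]
    exact pow_le_pow_left₀ (Finset.sum_nonneg fun i _ => by positivity) h2 J
  rw [← Finset.prod_pow]
  simp only [← pow_mul, mul_comm _ 2] at h1 ⊢
  rw [← hJ] at h1
  rcases Nat.eq_zero_or_pos J with h0 | h0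
  · have : ∀ i, c i = 0 := fun i => (Finset.sum_eq_zero_iff.mp (hJ ▸ h0)) i (Finset.mem_univ i)
    simp [h0, this]
  have hJR : (0 : ℝ) < (J : ℝ) ^ J := by positivity
  refine le_of_mul_le_mul_right (h1.trans ?_) hJR
  rw [mul_assoc]
  exact mul_le_mul_of_nonneg_left h3 hC

/-- A single term of the series of `exp m` is at most the whole. -/
theorem pow_self_mul_exp_neg_le_factorial (m : ℕ) :
    (m : ℝ) ^ m * Real.exp (-m) ≤ (Nat.factorial m : ℝ) := by
  have h := Real.pow_div_factorial_le_exp (m : ℝ) (by positivity) m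
  rw [div_le_iff₀ (by positivity)] at h
  rw [Real.exp_neg, ← div_eq_mul_inv, div_le_iff₀ (Real.exp_pos _), mul_comm]
  exact h

theorem exp_one_mul_pow_le {m : ℕ} (hm : 0 < m) :
    Real.exp 1 * (m : ℝ) ^ (m + 1) ≤ ((m + 1 : ℕ) : ℝ) ^ (m + 1) := by
  have hm' : (0 : ℝ) < m := by exact_mod_cast hm
  have h1 : (m : ℝ) / (m + 1) ≤ Real.exp (-(1 / (m + 1))) := by
    have := Real.add_one_le_exp (-(1 / ((m : ℝ) + 1)))
    refine le_trans (le_of_eq ?_) this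
    field_simp
    ring
  have h2 := pow_le_pow_left₀ (by positivity) h1 (m + 1)
  rw [← Real.exp_nat_mul, div_pow] at h2
  have h3 : ((m + 1 : ℕ) : ℝ) * (-(1 / ((m : ℝ) + 1))) = -1 := by
    push_cast; field_simp
  rw [h3, Real.exp_neg, div_le_iff₀ (by positivity), ← div_eq_inv_mul,
    le_div_iff₀ (Real.exp_pos _)] at h2
  push_cast
  linarith

/-- A crude Stirling bound, sharp up to a polynomial factor. The induction gives the factor `m` for
positive `m`; `m + 1` also covers `m = 0`. -/
theorem factorial_le (m : ℕ) :
    (Nat.factorial m : ℝ) ≤ Real.exp 1 * (m + 1) * ((m : ℝ) ^ m * Real.exp (-m)) := by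
  have key : ∀ m : ℕ, 0 < m →
      (Nat.factorial m : ℝ) ≤ Real.exp 1 * m * ((m : ℝ) ^ m * Real.exp (-m)) := by
    intro m hm
    induction m, hm using Nat.le_induction with
    | base =>
      have : Real.exp 1 * Real.exp (-1) = 1 := by rw [← Real.exp_add]; simp
      simp [this]
    | succ m hm ih =>
      have h1 := exp_one_mul_pow_le hm
      have h2 : Real.exp (-(m : ℝ)) = Real.exp 1 * Real.exp (-((m + 1 : ℕ) : ℝ)) := by
        rw [← Real.exp_add]; push_cast; congr 1; ring
      rw [Nat.factorial_succ, Nat.cast_mul]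
      calc ((m + 1 : ℕ) : ℝ) * (Nat.factorial m : ℝ)
          ≤ ((m + 1 : ℕ) : ℝ) * (Real.exp 1 * m * ((m : ℝ) ^ m * Real.exp (-m))) := by gcongr
        _ = Real.exp 1 * ((m + 1 : ℕ) : ℝ) * ((Real.exp 1 * (m : ℝ) ^ (m + 1)) *
            Real.exp (-((m + 1 : ℕ) : ℝ))) := by rw [h2]; ring
        _ ≤ _ := by gcongr
  rcases Nat.eq_zero_or_pos m with rfl | hm
  · have := Real.one_le_exp (zero_le_one (α := ℝ))
    simp [this]
  · refine (key m hm).trans ?_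
    gcongr
    linarith

open Equiv in
/-- The number of permutations that match one colouring with another. -/
theorem card_perm_matching {α : Type*} [Fintype α] [DecidableEq α] (f g : α → Bool) :
    Nat.card {σ : Perm α // ∀ i, g (σ i) = f i} =
      if Fintype.card {i // f i = true} = Fintype.card {i // g i = true} then
        (Fintype.card {i // f i = true}).factorial * (Fintype.card {i // f i = false}).factorial
      else 0 := by
  rw [Nat.card_eq_fintype_card]
  split_ifs with h
  · have h' : Fintype.card {i // f i = false} = Fintype.card {i // g i = false} := by
      have h1 := Fintype.card_subtype_compl (fun i => f i = true)
      have h2 := Fintype.card_subtype_compl (fun i => g i = true)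
      simp only [Bool.not_eq_true] at h1 h2
      rw [h1, h2, h]
    have hb : ∀ b, Nonempty ({i // f i = b} ≃ {i // g i = b}) := fun b => by
      cases b
      · exact ⟨Fintype.equivOfCardEq h'⟩
      · exact ⟨Fintype.equivOfCardEq h⟩
    let e := fun b => (hb b).some
    -- One matching permutation; multiplying by its inverse identifies all the matching ones with
    -- the stabilizer of `f`.
    let σ₀ : Perm α := (Equiv.sigmaFiberEquiv f).symm.trans
      ((Equiv.sigmaCongrRight e).trans (Equiv.sigmaFiberEquiv g))
    have hσ₀ : ∀ i, g (σ₀ i) = f i := fun i => (e (f i) ⟨i, rfl⟩).2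
    have : {σ : Perm α // ∀ i, g (σ i) = f i} ≃ {σ : Perm α // f ∘ σ = f} :=
      { toFun := fun σ => ⟨σ₀⁻¹ * σ.1, by
          funext i
          have := hσ₀ ((σ₀⁻¹ * σ.1) i)
          rw [← Perm.mul_apply, mul_inv_cancel_left, σ.2] at this
          exact this.symm⟩
        invFun := fun σ => ⟨σ₀ * σ.1, fun i => by
          rw [Perm.mul_apply, hσ₀]; exact congrFun σ.2 i⟩
        left_inv := fun σ => by simp
        right_inv := fun σ => by simp }
    rw [Fintype.card_congr this, DomMulAct.stabilizer_card, Fintype.prod_bool]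
  · rw [Fintype.card_eq_zero_iff]
    refine ⟨fun σ => h ?_⟩
    refine Fintype.card_congr (σ.1.subtypeEquiv fun i => ?_)
    rw [σ.2]

end SpinNetworkBounds

-- Both sides are multiplicative, which reduces the claim to a transposition within a single fibre.
open Equiv in
theorem Equiv.Perm.sign_sigmaCongrRight {ι : Type*} {β : ι → Type*} [Fintype ι] [DecidableEq ι]
    [∀ i, Fintype (β i)] [∀ i, DecidableEq (β i)] (σ : ∀ i, Perm (β i)) :
    Perm.sign (Perm.sigmaCongrRight σ) = ∏ i, Perm.sign (σ i) := by
  have hsingle : ∀ i (π : Perm (β i)),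
      Perm.sign (Perm.sigmaCongrRight (Pi.mulSingle i π)) = Perm.sign π := by
    intro i π
    induction π using Perm.swap_induction_on with
    | one => rw [Pi.mulSingle_one]; simp
    | swap_mul f x y hxy ih =>
      have h1 : Perm.sigmaCongrRight (Pi.mulSingle i (swap x y * f)) =
          Perm.sigmaCongrRight (Pi.mulSingle i (swap x y)) *
            Perm.sigmaCongrRight (Pi.mulSingle i f) := by
        rw [Pi.mulSingle_mul, Perm.sigmaCongrRight_mul]
      have h2 : Perm.sigmaCongrRight (Pi.mulSingle i (swap x y)) =
          swap (⟨i, x⟩ : Σ i, β i) ⟨i, y⟩ := by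
        ext1 ⟨j, z⟩
        simp only [Perm.sigmaCongrRight, Equiv.sigmaCongrRight_apply]
        rcases eq_or_ne j i with rfl | hj
        · rw [Pi.mulSingle_eq_same]
          simp only [swap_apply_def, Sigma.mk.injEq, heq_eq_eq, true_and]
          split_ifs <;> rfl
        · rw [Pi.mulSingle_eq_of_ne hj, swap_apply_of_ne_of_ne]
          · rfl
          · simp [hj]
          · simp [hj]
      rw [h1, Perm.sign_mul, ih, h2, Perm.sign_swap, Perm.sign_mul, Perm.sign_swap hxy]
      simpa using hxy
  have key : ∀ s : Finset ι, ∀ σ : ∀ i, Perm (β i), (∀ i ∉ s, σ i = 1) →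
      Perm.sign (Perm.sigmaCongrRight σ) = ∏ i ∈ s, Perm.sign (σ i) := by
    intro s
    induction s using Finset.induction_on with
    | empty =>
      intro σ h
      have : σ = 1 := funext fun i => h i (by simp)
      rw [this]; simp
    | insert a s ha ih =>
      intro σ h
      have h1 : σ = Pi.mulSingle a (σ a) * Function.update σ a 1 := by
        funext i
        rcases eq_or_ne i a with rfl | hi
        · simp
        · simp [hi]
      rw [h1, ← Perm.sigmaCongrRight_mul, Perm.sign_mul, hsingle, ih, Finset.prod_insert ha]
      · congr 1
        · simp
        · refine Finset.prod_congr rfl fun i hi => ?_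
          have : i ≠ a := fun h => ha (h ▸ hi)
          simp [this]
      · intro i hi
        rcases eq_or_ne i a with rfl | hia
        · simp
        · rw [Function.update_of_ne hia]
          exact h i (by simp [hi, hia])
  exact key Finset.univ σ (by simp)

/-! ### Strands of a spin network as two systems of arcs -/

namespace CubicRibbonGraph

variable {V E : Type*} {G : CubicRibbonGraph V E} {γ : E → ℕ}

theorem Admissible.two_mul_corner (hγ : G.Admissible γ) (v : V) (k : Fin 3) :
    2 * G.corner γ v k + G.label γ v (k + 2) = G.label γ v k + G.label γ v (k + 1) := by
  obtain ⟨⟨n, h1⟩, h2, h3⟩ := hγ v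
  rw [abs_le] at h2
  fin_cases k <;> simp only [corner, Fin.zero_eta, Fin.mk_one, Fin.reduceFinMk, Fin.reduceAdd,
    zero_add] <;> omega

/-- Each strand arriving at a half-edge turns to the next half-edge or to the previous one, which is
`k + 2` modulo 3. -/
theorem Admissible.corner_add_corner (hγ : G.Admissible γ) (v : V) (k : Fin 3) :
    G.corner γ v k + G.corner γ v (k + 2) = G.label γ v k := by
  have h0 := hγ.two_mul_corner v k
  have h1 := hγ.two_mul_corner v (k + 2)
  rw [show k + 2 + 2 = k + 1 by fin_cases k <;> rfl,
    show k + 2 + 1 = k by fin_cases k <;> rfl] at h1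
  omega

theorem Admissible.corner_le (hγ : G.Admissible γ) (v : V) (k : Fin 3) :
    G.corner γ v k ≤ G.label γ v k := by
  have := hγ.corner_add_corner v k
  omega

theorem Admissible.corner_le_succ (hγ : G.Admissible γ) (v : V) (k : Fin 3) :
    G.corner γ v k ≤ G.label γ v (k + 1) := by
  have := hγ.corner_add_corner v (k + 1)
  rw [show k + 1 + 2 = k by fin_cases k <;> rfl] at this
  omega

theorem Admissible.sum_label (hγ : G.Admissible γ) (v : V) :
    ∑ k, G.label γ v k = 2 * ∑ k, G.corner γ v k := by
  simp only [Fin.sum_univ_three]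
  have h0 := hγ.corner_add_corner v 0
  have h1 := hγ.corner_add_corner v 1
  have h2 := hγ.corner_add_corner v 2
  simp only [Fin.reduceAdd, zero_add] at h0 h1 h2
  omega

theorem halfEdge_bijective (hG : ∀ e, ¬ G.IsTrivialComponent e) :
    Function.Bijective G.halfEdge := by
  refine ⟨G.halfEdge_injective, ?_⟩
  rintro ⟨e, b⟩
  have := hG e
  simp only [IsTrivialComponent, not_forall, not_not] at this
  obtain ⟨b', hb'⟩ := this
  rcases eq_or_ne b b' with rfl | h
  · exact hb'
  · have := G.other_end_attached e b' hb'
    rwa [show (!b') = b by cases b <;> cases b' <;> simp_all] at this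

variable (G γ) in
/-- The strands in the discs of the vertices. -/
abbrev VertexStrand : Type _ := Σ p : V × Fin 3, Fin (G.corner γ p.1 p.2)

/-- The two ends of a strand in the disc of a vertex. -/
def vertexStrandEnd (hγ : G.Admissible γ) : G.VertexStrand γ × Bool → StrandEnd γ
  | (⟨(v, k), i⟩, false) => ⟨G.halfEdge (v, k), ⟨G.label γ v k - 1 - i, by
      have h1 := hγ.corner_le v k
      have h2 := i.2
      change G.label γ v k - 1 - i < G.label γ v k
      dsimp only at h2
      omega⟩⟩
  | (⟨(v, k), i⟩, true) => ⟨G.halfEdge (v, k + 1), ⟨i, i.2.trans_le (hγ.corner_le_succ v k)⟩⟩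

theorem strandEnd_eq_iff {h h' : E × Bool} {i : Fin (γ h.1)} {j : Fin (γ h'.1)} :
    (⟨h, i⟩ : StrandEnd γ) = ⟨h', j⟩ ↔ h = h' ∧ (i : ℕ) = j := by
  constructor
  · intro hh
    cases hh
    exact ⟨rfl, rfl⟩
  · rintro ⟨rfl, h2⟩
    rw [Fin.ext h2]

/-- At half-edge `k` the first `corner (k + 2)` positions receive `true` ends and the last `corner
k` positions `false` ends; `corner_add_corner` says that these two blocks fill the half-edge without
overlap. -/
theorem vertexStrandEnd_bijective (hγ : G.Admissible γ) (hG : ∀ e, ¬ G.IsTrivialComponent e) :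
    Function.Bijective (vertexStrandEnd hγ) := by
  have hadd : ∀ k k' : Fin 3, k = k' + 1 → k' = k + 2 := by decide
  constructor
  · rintro ⟨⟨⟨v, k⟩, i⟩, b⟩ ⟨⟨⟨v', k'⟩, i'⟩, b'⟩ h
    have hi := i.2
    have hi' := i'.2
    dsimp only at hi hi'
    have h1 := hγ.corner_add_corner v k
    have h1' := hγ.corner_add_corner v' k'
    cases b <;> cases b' <;>
      simp only [vertexStrandEnd, strandEnd_eq_iff, G.halfEdge_injective.eq_iff, Prod.mk.injEq,
        add_left_inj] at h <;> obtain ⟨⟨rfl, h2⟩, h3⟩ := h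
    · subst h2
      have : i = i' := Fin.ext (by omega)
      rw [this]
    · have := hadd _ _ h2
      subst this
      omega
    · have := hadd _ _ h2.symm
      subst this
      omega
    · subst h2
      rw [Fin.ext h3]
  · rintro ⟨h, p⟩
    obtain ⟨⟨v, k⟩, rfl⟩ := (halfEdge_bijective hG).2 h
    have h1 := hγ.corner_add_corner v k
    have hp : (p : ℕ) < G.label γ v k := p.2
    by_cases hpc : (p : ℕ) < G.corner γ v (k + 2)
    · refine ⟨(⟨(v, k + 2), ⟨p, hpc⟩⟩, true), ?_⟩
      simp only [vertexStrandEnd, strandEnd_eq_iff, and_true]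
      congr 2
      fin_cases k <;> rfl
    · refine ⟨(⟨(v, k), ⟨G.label γ v k - 1 - p, by dsimp only; omega⟩⟩, false), ?_⟩
      simp only [vertexStrandEnd, strandEnd_eq_iff, true_and]
      omega

/-- Every strand end is an end of exactly one strand in the disc of a vertex. -/
noncomputable def vertexEquiv (hγ : G.Admissible γ) (hG : ∀ e, ¬ G.IsTrivialComponent e) :
    G.VertexStrand γ × Bool ≃ StrandEnd γ :=
  Equiv.ofBijective _ (vertexStrandEnd_bijective hγ hG)

/-- The two ends of a strand on an edge. -/
def edgeEquiv (γ : E → ℕ) : (Σ e, Fin (γ e)) × Bool ≃ StrandEnd γ where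
  toFun
    | (⟨e, i⟩, false) => ⟨(e, false), i⟩
    | (⟨e, i⟩, true) => ⟨(e, true), i.rev⟩
  invFun
    | ⟨(e, false), i⟩ => (⟨e, i⟩, false)
    | ⟨(e, true), i⟩ => (⟨e, i.rev⟩, true)
  left_inv := by rintro ⟨⟨e, i⟩, _ | _⟩ <;> simp
  right_inv := by rintro ⟨⟨e, _ | _⟩, i⟩ <;> simp

open StrandGluing

section

variable [Fintype V] [Fintype E]

/-- Both kinds of strands pair up the same set of ends. An arbitrary bijection between them suffices
to make the gluing a permutation of one set, so that it has a sign. -/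
theorem nonempty_strand_equiv (hγ : G.Admissible γ) (hG : ∀ e, ¬ G.IsTrivialComponent e) :
    Nonempty ((Σ e, Fin (γ e)) ≃ G.VertexStrand γ) := by
  have h := Fintype.card_congr ((edgeEquiv γ).trans (vertexEquiv hγ hG).symm)
  rw [Fintype.card_prod, Fintype.card_prod, Fintype.card_bool] at h
  exact ⟨Fintype.equivOfCardEq (by omega)⟩

/-- The strands on the edges in the state `σ`, as a permutation of the ends of the strands in the
discs of the vertices. -/
noncomputable def gluing (hγ : G.Admissible γ) (hG : ∀ e, ¬ G.IsTrivialComponent e)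
    (σ : ∀ e, Equiv.Perm (Fin (γ e))) : Equiv.Perm (G.VertexStrand γ × Bool) :=
  ((nonempty_strand_equiv hγ hG).some.symm.prodCongr (Equiv.refl Bool)).trans
    ((Equiv.prodCongrLeft fun b => if b then Equiv.Perm.sigmaCongrRight σ else 1).trans
      ((edgeEquiv γ).trans (vertexEquiv hγ hG).symm))

variable (hγ : G.Admissible γ) (hG : ∀ e, ¬ G.IsTrivialComponent e)
  (σ : ∀ e, Equiv.Perm (Fin (γ e)))

theorem vertexEquiv_gluing_false (e : E) (i : Fin (γ e)) :
    vertexEquiv hγ hG (gluing hγ hG σ ((nonempty_strand_equiv hγ hG).some ⟨e, i⟩, false)) =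
      ⟨(e, false), i⟩ := by
  simp [gluing, edgeEquiv]

theorem vertexEquiv_gluing_true (e : E) (i : Fin (γ e)) :
    vertexEquiv hγ hG (gluing hγ hG σ ((nonempty_strand_equiv hγ hG).some ⟨e, i⟩, true)) =
      ⟨(e, true), (σ e i).rev⟩ := by
  simp [gluing, edgeEquiv, Equiv.Perm.sigmaCongrRight]

/-- Changing the state composes the gluing with a permutation of the `true` ends alone. Thus the
Penrose sign is the sign of the gluing, up to a factor independent of the state. -/
theorem sign_gluing [DecidableEq V] [DecidableEq E] :
    Equiv.Perm.sign (gluing hγ hG σ) =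
      Equiv.Perm.sign (gluing hγ hG 1) * ∏ e, Equiv.Perm.sign (σ e) := by
  set θ := (nonempty_strand_equiv hγ hG).some
  have h : gluing hγ hG σ = gluing hγ hG 1 * Equiv.prodCongrLeft
      fun b => if b then θ.permCongr (Equiv.Perm.sigmaCongrRight σ) else 1 := by
    ext1 ⟨q, b⟩
    obtain ⟨⟨e, i⟩, rfl⟩ := θ.surjective q
    apply (vertexEquiv hγ hG).injective
    cases b
    · simp only [Equiv.Perm.mul_apply, Equiv.prodCongrLeft_apply]
      exact (vertexEquiv_gluing_false hγ hG σ e i).trans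
        (vertexEquiv_gluing_false hγ hG 1 e i).symm
    · simp only [Equiv.Perm.mul_apply, Equiv.prodCongrLeft_apply, if_true,
        Equiv.permCongr_apply, Equiv.symm_apply_apply]
      exact (vertexEquiv_gluing_true hγ hG σ e i).trans
        (vertexEquiv_gluing_true hγ hG 1 e (σ e i)).symm
  rw [h, Equiv.Perm.sign_mul, Equiv.Perm.sign_prodCongrLeft, Fintype.prod_bool]
  simp [Equiv.Perm.sign_sigmaCongrRight]

/-- The constructors `vertex` and `edge` are the two systems of arcs; `closing` never occurs without
trivial components. -/
theorem numCurves_eq : G.numCurves γ σ = Nat.card (Quot (Rel (gluing hγ hG σ))) := by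
  refine Nat.card_congr (Quot.congr (vertexEquiv hγ hG) fun x y => ?_).symm
  constructor
  · intro h
    cases h with
    | left q =>
      obtain ⟨⟨v, k⟩, i⟩ := q
      have h1 := hγ.corner_le v k
      have h2 : (i : ℕ) < G.corner γ v k := i.2
      refine Connected.vertex v k _ _ ?_ ?_
      · change G.label γ v k - 1 - i + i + 1 = _
        omega
      · exact h2
    | right q =>
      obtain ⟨⟨e, i⟩, rfl⟩ := (nonempty_strand_equiv hγ hG).some.surjective q
      rw [vertexEquiv_gluing_false, vertexEquiv_gluing_true]
      exact .edge e i
  · generalize hx : vertexEquiv hγ hG x = x'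
    generalize hy : vertexEquiv hγ hG y = y'
    intro h
    cases h with
    | vertex v k p q hpq hq =>
      have hx' : x = (⟨(v, k), ⟨q, hq⟩⟩, false) := by
        apply (vertexEquiv hγ hG).injective
        rw [hx]
        change _ = (⟨G.halfEdge (v, k), _⟩ : StrandEnd γ)
        rw [strandEnd_eq_iff]
        refine ⟨rfl, ?_⟩
        dsimp only
        omega
      have hy' : y = (⟨(v, k), ⟨q, hq⟩⟩, true) := by
        apply (vertexEquiv hγ hG).injective
        rw [hy]
        rfl
      rw [hx', hy']
      exact .left _
    | edge e i =>
      rw [← vertexEquiv_gluing_false hγ hG σ] at hx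
      rw [← vertexEquiv_gluing_true hγ hG σ] at hy
      rw [(vertexEquiv hγ hG).injective hx, (vertexEquiv hγ hG).injective hy]
      exact .right _
    | closing e he i => exact absurd he (hG e)

end

end CubicRibbonGraph

/-! ### The state sum and its bounds -/

namespace CubicRibbonGraph

open StrandGluing SpinNetworkBounds

variable {V E : Type*} {G : CubicRibbonGraph V E} {γ : E → ℕ}

/-- The spins at the ends of the strands, given the spins at the beginnings of the strands in the
discs of the vertices. -/
noncomputable def strandSpin (hγ : G.Admissible γ) (hG : ∀ e, ¬ G.IsTrivialComponent e)
    (f : G.VertexStrand γ → Bool) (x : StrandEnd γ) : Bool :=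
  spin f ((vertexEquiv hγ hG).symm x)

/-- The number of spins equal to `true` at one end of an edge. -/
noncomputable def upCount (hγ : G.Admissible γ) (hG : ∀ e, ¬ G.IsTrivialComponent e)
    (f : G.VertexStrand γ → Bool) (h : E × Bool) : ℕ :=
  Fintype.card {i : Fin (γ h.1) // strandSpin hγ hG f ⟨h, i⟩ = true}

/-- The number of ways to match `m` up spins and `a - m` down spins with `m'` down spins and
`a - m'` up spins. -/
def matchCount (a m m' : ℕ) : ℕ :=
  if a - m = m' then m.factorial * (a - m).factorial else 0

/-- The weight of an edge in the state sum. -/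
def edgeWeight [Fintype E] (γ : E → ℕ) (M : E × Bool → ℕ) : ℤ :=
  ∏ e, (-1) ^ M (e, false) * (matchCount (γ e) (M (e, false)) (M (e, true)) : ℤ)

/-- The bound of the tensor at a vertex. -/
noncomputable def vertexBound (G : CubicRibbonGraph V E) (γ : E → ℕ) (v : V) : ℝ :=
  √((∏ k, (G.corner γ v k : ℝ) ^ G.corner γ v k) *
    ((∑ k, G.corner γ v k : ℕ) : ℝ) ^ (∑ k, G.corner γ v k))

/-- Equality holds when `m' = a - m`. The square roots share the weight of an edge equally between
its two ends. -/
theorem matchCount_le {a m m' : ℕ} (hm : m ≤ a) :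
    (matchCount a m m' : ℝ) ≤ √((m.factorial * (a - m).factorial : ℕ) : ℝ) *
      √((m'.factorial * (a - m').factorial : ℕ) : ℝ) := by
  rw [matchCount]
  split_ifs with h
  · subst h
    rw [Nat.sub_sub_self hm, mul_comm (a - m).factorial, Real.mul_self_sqrt (by positivity)]
  · simp only [Nat.cast_zero]
    positivity

/-- Stirling in the form needed for cancellation: the last factor is the value of the monomial in
Cauchy's estimate at the vertices. -/
theorem sqrt_factorial_le {a m : ℕ} (hm : m ≤ a) :
    √((m.factorial * (a - m).factorial : ℕ) : ℝ) ≤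
      Real.exp 1 * (a + 1) * Real.exp (-(a / 2 : ℝ)) *
        (√(m : ℝ) ^ m * √((a - m : ℕ) : ℝ) ^ (a - m)) := by
  rw [Real.sqrt_le_left (by positivity)]
  have h1 := factorial_le m
  have h2 := factorial_le (a - m)
  have h3 : (m : ℝ) ≤ a := by exact_mod_cast hm
  have h4 : ((a - m : ℕ) : ℝ) ≤ a := by exact_mod_cast Nat.sub_le a m
  have h5 : Real.exp (-(a / 2 : ℝ)) ^ 2 = Real.exp (-m) * Real.exp (-((a - m : ℕ) : ℝ)) := by
    rw [← Real.exp_nat_mul, ← Real.exp_add, Nat.cast_sub hm]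
    congr 1
    push_cast
    ring
  push_cast
  calc (m.factorial : ℝ) * (a - m).factorial
      ≤ (Real.exp 1 * (m + 1) * ((m : ℝ) ^ m * Real.exp (-m))) *
        (Real.exp 1 * (((a - m : ℕ) : ℝ) + 1) *
          (((a - m : ℕ) : ℝ) ^ (a - m) * Real.exp (-((a - m : ℕ) : ℝ)))) := by gcongr
    _ ≤ (Real.exp 1 * (a + 1) * ((m : ℝ) ^ m * Real.exp (-m))) *
        (Real.exp 1 * (a + 1) *
          (((a - m : ℕ) : ℝ) ^ (a - m) * Real.exp (-((a - m : ℕ) : ℝ)))) := by gcongr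
    _ = _ := by
      rw [mul_pow, mul_pow _ (Real.exp (-(a / 2 : ℝ))), h5, mul_pow (√(m : ℝ) ^ m), ← pow_mul,
        ← pow_mul, mul_comm m 2, mul_comm (a - m) 2, pow_mul √(m : ℝ),
        pow_mul √((a - m : ℕ) : ℝ), Real.sq_sqrt (by positivity), Real.sq_sqrt (by positivity)]
      ring

theorem abs_edgeWeight_le [Fintype E] (M : E × Bool → ℕ) (hM : ∀ h, M h ≤ γ h.1) :
    |(edgeWeight γ M : ℝ)| ≤ ∏ h : E × Bool,
      (Real.exp 1 * (γ h.1 + 1) * Real.exp (-(γ h.1 / 2 : ℝ)) *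
        (√(M h) ^ M h * √((γ h.1 - M h : ℕ) : ℝ) ^ (γ h.1 - M h))) := by
  have h1 : |(edgeWeight γ M : ℝ)| =
      ∏ e, (matchCount (γ e) (M (e, false)) (M (e, true)) : ℝ) := by
    rw [edgeWeight]
    push_cast
    rw [Finset.abs_prod]
    refine Finset.prod_congr rfl fun e _ => ?_
    simp [abs_mul]
  rw [h1, Fintype.prod_prod_type]
  refine Finset.prod_le_prod (fun e _ => by positivity) fun e _ => ?_
  rw [Fintype.prod_bool, mul_comm]
  exact (matchCount_le (hM (e, false))).trans
    (mul_le_mul (sqrt_factorial_le (hM (e, false))) (sqrt_factorial_le (hM (e, true)))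
      (Real.sqrt_nonneg _) (by positivity))

/-- With `P = ∏ c k ^ c k`, the factorials are at least `P * exp (-J)`: the exponential cancels and
`√(P * J ^ J) / P = √(J ^ J / P)`. -/
theorem vertexBound_mul_le (v : V) :
    vertexBound G γ v * Real.exp (-((∑ k, G.corner γ v k : ℕ) : ℝ)) *
      ((Nat.factorial (G.corner γ v 0) * Nat.factorial (G.corner γ v 1) *
        Nat.factorial (G.corner γ v 2) : ℕ) : ℝ)⁻¹ ≤
      √(((∑ k, G.corner γ v k : ℕ) : ℝ) ^ (∑ k, G.corner γ v k) /
        ∏ k, (G.corner γ v k : ℝ) ^ G.corner γ v k) := by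
  set c := G.corner γ v
  set J := ∑ k, c k with hJ
  set P := ∏ k, (c k : ℝ) ^ c k with hP
  have hP0 : 0 < P := Finset.prod_pos fun k _ => by
    rcases Nat.eq_zero_or_pos (c k) with h | h
    · simp [h]
    · positivity
  have h1 : P * Real.exp (-(J : ℝ)) ≤
      ((Nat.factorial (c 0) * Nat.factorial (c 1) * Nat.factorial (c 2) : ℕ) : ℝ) := by
    have h2 : P * Real.exp (-(J : ℝ)) = ∏ k, ((c k : ℝ) ^ c k * Real.exp (-(c k : ℝ))) := by
      rw [Finset.prod_mul_distrib, ← Real.exp_sum, Finset.sum_neg_distrib, hJ, Nat.cast_sum]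
    rw [h2]
    push_cast
    rw [← Fin.prod_univ_three (fun k => (Nat.factorial (c k) : ℝ))]
    exact Finset.prod_le_prod (fun k _ => by positivity)
      fun k _ => pow_self_mul_exp_neg_le_factorial (c k)
  have h3 : √((J : ℝ) ^ J / P) = √(P * (J : ℝ) ^ J) / P := by
    rw [Real.sqrt_div' _ hP0.le, Real.sqrt_mul hP0.le, div_eq_div_iff (by positivity) hP0.ne']
    linear_combination (-√((J : ℝ) ^ J)) * Real.mul_self_sqrt hP0.le
  rw [h3, vertexBound, ← div_eq_mul_inv, div_le_div_iff₀ (by positivity) hP0, mul_assoc]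
  gcongr
  rw [mul_comm]
  exact h1

variable (hγ : G.Admissible γ) (hG : ∀ e, ¬ G.IsTrivialComponent e)

theorem upCount_le (f : G.VertexStrand γ → Bool) (h : E × Bool) :
    upCount hγ hG f h ≤ γ h.1 := by
  refine (Fintype.card_subtype_le _).trans_eq ?_
  simp

theorem card_strandSpin_eq_false (f : G.VertexStrand γ → Bool) (h : E × Bool) :
    Fintype.card {i : Fin (γ h.1) // strandSpin hγ hG f ⟨h, i⟩ = false} =
      γ h.1 - upCount hγ hG f h := by
  have h1 := Fintype.card_subtype_compl
    (fun i : Fin (γ h.1) => strandSpin hγ hG f ⟨h, i⟩ = true)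
  simp only [Bool.not_eq_true, Fintype.card_fin] at h1
  exact h1

/-- A product over the ends of the strands on one end of an edge. -/
theorem prod_strandSpin {R : Type*} [CommMonoid R] (f : G.VertexStrand γ → Bool) (h : E × Bool)
    (w : Bool → R) :
    ∏ i : Fin (γ h.1), w (strandSpin hγ hG f ⟨h, i⟩) =
      w true ^ upCount hγ hG f h * w false ^ (γ h.1 - upCount hγ hG f h) := by
  rw [← card_strandSpin_eq_false, upCount, Fintype.card_subtype, Fintype.card_subtype,
    ← Finset.prod_fiberwise Finset.univ (fun i => strandSpin hγ hG f ⟨h, i⟩),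
    Fintype.prod_bool]
  congr 1 <;>
  · rw [← Finset.prod_const]
    refine Finset.prod_congr rfl fun i hi => ?_
    rw [(Finset.mem_filter.mp hi).2]

variable [Fintype V] [Fintype E]

theorem compat_gluing_iff (σ : ∀ e, Equiv.Perm (Fin (γ e))) (f : G.VertexStrand γ → Bool) :
    Compat (gluing hγ hG σ) f ↔ ∀ e i, strandSpin hγ hG f ⟨(e, true), (σ e i).rev⟩ =
      !strandSpin hγ hG f ⟨(e, false), i⟩ := by
  have h : ∀ e i, (spin f (gluing hγ hG σ ((nonempty_strand_equiv hγ hG).some ⟨e, i⟩, true)) =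
        !spin f (gluing hγ hG σ ((nonempty_strand_equiv hγ hG).some ⟨e, i⟩, false))) ↔
      (strandSpin hγ hG f ⟨(e, true), (σ e i).rev⟩ =
        !strandSpin hγ hG f ⟨(e, false), i⟩) := fun e i => by
    rw [strandSpin, strandSpin, ← vertexEquiv_gluing_false hγ hG σ,
      ← vertexEquiv_gluing_true hγ hG σ, Equiv.symm_apply_apply, Equiv.symm_apply_apply]
  constructor
  · exact fun hc e i => (h e i).mp (hc _)
  · intro hc q
    obtain ⟨⟨e, i⟩, rfl⟩ := (nonempty_strand_equiv hγ hG).some.surjective q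
    exact (h e i).mpr (hc e i)

theorem prod_eps_gluing (σ : ∀ e, Equiv.Perm (Fin (γ e))) (f : G.VertexStrand γ → Bool) :
    ∏ q, eps (spin f (gluing hγ hG σ (q, false))) = ∏ e, (-1) ^ upCount hγ hG f (e, false) := by
  rw [← (nonempty_strand_equiv hγ hG).some.prod_comp, Fintype.prod_sigma]
  refine Finset.prod_congr rfl fun e _ => ?_
  have h : ∀ i, eps (spin f (gluing hγ hG σ ((nonempty_strand_equiv hγ hG).some ⟨e, i⟩, false))) =
      eps (strandSpin hγ hG f ⟨(e, false), i⟩) := fun i => by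
    rw [strandSpin, ← vertexEquiv_gluing_false hγ hG σ, Equiv.symm_apply_apply]
  rw [Finset.prod_congr rfl fun i _ => h i, prod_strandSpin hγ hG f (e, false) eps]
  simp [eps]

/-- The generating polynomial of the vertex weights. -/
theorem sum_eps_mul_prod [DecidableEq V] (x y : E × Bool → ℂ) :
    ∑ f, (∏ q, (eps (f q) : ℂ)) *
      ∏ h : E × Bool, (x h ^ upCount hγ hG f h * y h ^ (γ h.1 - upCount hγ hG f h)) =
    ∏ v, ∏ k, (y (G.halfEdge (v, k)) * x (G.halfEdge (v, k + 1)) -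
      x (G.halfEdge (v, k)) * y (G.halfEdge (v, k + 1))) ^ G.corner γ v k := by
  let w : E × Bool → Bool → ℂ := fun h b => if b then x h else y h
  have h1 : ∀ f : G.VertexStrand γ → Bool,
      ∏ h : E × Bool, (x h ^ upCount hγ hG f h * y h ^ (γ h.1 - upCount hγ hG f h)) =
        ∏ q : G.VertexStrand γ, (w (G.halfEdge q.1) (f q) *
          w (G.halfEdge (q.1.1, q.1.2 + 1)) (!f q)) := by
    intro f
    have h2 : ∏ h : E × Bool, (x h ^ upCount hγ hG f h * y h ^ (γ h.1 - upCount hγ hG f h)) =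
        ∏ z : StrandEnd γ, w z.1 (strandSpin hγ hG f z) := by
      rw [Fintype.prod_sigma]
      refine Finset.prod_congr rfl fun h _ => ?_
      exact (prod_strandSpin hγ hG f h (w h)).symm
    rw [h2, ← (vertexEquiv hγ hG).prod_comp, Fintype.prod_prod_type]
    refine Finset.prod_congr rfl fun q _ => ?_
    rw [Fintype.prod_bool, mul_comm]
    obtain ⟨⟨v, k⟩, i⟩ := q
    simp only [strandSpin, Equiv.symm_apply_apply, spin, Bool.xor_false, Bool.xor_true]
    rfl
  have h3 : ∀ f : G.VertexStrand γ → Bool, (∏ q, (eps (f q) : ℂ)) *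
      ∏ h : E × Bool, (x h ^ upCount hγ hG f h * y h ^ (γ h.1 - upCount hγ hG f h)) =
        ∏ q : G.VertexStrand γ, ((eps (f q) : ℂ) * (w (G.halfEdge q.1) (f q) *
          w (G.halfEdge (q.1.1, q.1.2 + 1)) (!f q))) := fun f => by
    rw [h1, ← Finset.prod_mul_distrib]
  -- The spins of the vertex strands are independent, so the sum factors into one two-term sum, a
  -- minor, per strand.
  rw [Finset.sum_congr rfl fun f _ => h3 f,
    ← Fintype.prod_sum (fun (q : G.VertexStrand γ) (b : Bool) => (eps b : ℂ) *
      (w (G.halfEdge q.1) b * w (G.halfEdge (q.1.1, q.1.2 + 1)) (!b))),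
    Fintype.prod_sigma, Fintype.prod_prod_type]
  refine Finset.prod_congr rfl fun v _ => Finset.prod_congr rfl fun k _ => ?_
  dsimp only
  rw [Finset.prod_const, Finset.card_univ, Fintype.card_fin, Fintype.sum_bool]
  congr 1
  simp only [eps, w, if_true, Bool.not_true, Bool.not_false]
  simp
  ring

/-- For fixed spins, compatibility constrains each edge separately: its permutation must match the
negated spins at one end with the spins at the other. -/
theorem card_compatible_states [DecidableEq E] (f : G.VertexStrand γ → Bool) :
    (Finset.univ.filter fun σ : ∀ e, Equiv.Perm (Fin (γ e)) => Compat (gluing hγ hG σ) f).card =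
      ∏ e, matchCount (γ e) (upCount hγ hG f (e, false)) (upCount hγ hG f (e, true)) := by
  rw [← Fintype.card_subtype]
  have e1 : {σ : ∀ e, Equiv.Perm (Fin (γ e)) // Compat (gluing hγ hG σ) f} ≃
      ∀ e, {π : Equiv.Perm (Fin (γ e)) // ∀ i, strandSpin hγ hG f ⟨(e, true), (π i).rev⟩ =
        !strandSpin hγ hG f ⟨(e, false), i⟩} :=
    (Equiv.subtypeEquivRight fun σ => compat_gluing_iff hγ hG σ f).trans
      (Equiv.subtypePiEquivPi (p := fun e (π : Equiv.Perm (Fin (γ e))) =>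
        ∀ i, strandSpin hγ hG f ⟨(e, true), (π i).rev⟩ =
          !strandSpin hγ hG f ⟨(e, false), i⟩))
  rw [Fintype.card_congr e1, Fintype.card_pi]
  refine Finset.prod_congr rfl fun e _ => ?_
  refine Nat.card_eq_fintype_card.symm.trans
    ((card_perm_matching (α := Fin (γ e)) (fun i => !strandSpin hγ hG f ⟨(e, false), i⟩)
      (fun i => strandSpin hγ hG f ⟨(e, true), i.rev⟩)).trans ?_)
  rw [matchCount]
  have h1 : Fintype.card {i : Fin (γ e) // (!strandSpin hγ hG f ⟨(e, false), i⟩) = true} =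
      γ e - upCount hγ hG f (e, false) :=
    (Fintype.card_congr (Equiv.subtypeEquivRight fun i => by simp)).trans
      (card_strandSpin_eq_false hγ hG f (e, false))
  have h2 : Fintype.card {i : Fin (γ e) // (!strandSpin hγ hG f ⟨(e, false), i⟩) = false} =
      upCount hγ hG f (e, false) :=
    Fintype.card_congr (Equiv.subtypeEquivRight fun i => by simp)
  have h3 : Fintype.card {i : Fin (γ e) // strandSpin hγ hG f ⟨(e, true), i.rev⟩ = true} =
      upCount hγ hG f (e, true) :=
    Fintype.card_congr (Fin.revPerm.subtypeEquiv fun i => by rfl)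
  rw [h1, h2, h3, mul_comm]

variable [DecidableEq V] [DecidableEq E]

/-- The weight of the vertices in the state sum. -/
noncomputable def vertexWeight (M : E × Bool → ℕ) : ℤ :=
  ∑ f with upCount hγ hG f = M, ∏ q, eps (f q)

/-- The Penrose evaluation is, up to sign, a contraction of tensors attached to the vertices. -/
theorem abs_penroseEval :
    |G.penroseEval γ| = |∑ M ∈ Fintype.piFinset fun h : E × Bool => Finset.range (γ h.1 + 1),
      edgeWeight γ M * vertexWeight hγ hG M| := by
  set s₁ : ℤ := (Equiv.Perm.sign (gluing hγ hG 1) : ℤ) with hs₁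
  set N := Fintype.card (G.VertexStrand γ)
  have h1 : ∀ σ : ∀ e, Equiv.Perm (Fin (γ e)),
      (∏ e, (Equiv.Perm.sign (σ e) : ℤ)) * (-2) ^ G.numCurves γ σ =
        s₁ * (-1) ^ N * ∑ f, if Compat (gluing hγ hG σ) f then
          (∏ q, eps (f q)) * ∏ e, (-1) ^ upCount hγ hG f (e, false) else 0 := by
    intro σ
    have h2 := sign_mul_pow_card_quot (gluing hγ hG σ)
    simp only [prod_eps_gluing, ← numCurves_eq, Finset.sum_filter] at h2
    rw [mul_assoc, ← h2, sign_gluing]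
    have h3 : s₁ * s₁ = 1 := by
      rw [hs₁, ← Units.val_mul, Int.units_mul_self, Units.val_one]
    push_cast
    rw [← hs₁]
    linear_combination (-(∏ e, (Equiv.Perm.sign (σ e) : ℤ)) * (-2) ^ G.numCurves γ σ) * h3
  have h4 : G.penroseEval γ = s₁ * (-1) ^ N * ∑ f, (∏ q, eps (f q)) *
      edgeWeight γ (upCount hγ hG f) := by
    -- After the exchange of sums the summand depends on `σ` only through compatibility, so the
    -- inner sum is a count.
    rw [penroseEval, Finset.sum_congr rfl fun σ _ => h1 σ, ← Finset.mul_sum, Finset.sum_comm]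
    congr 1
    refine Finset.sum_congr rfl fun f _ => ?_
    rw [← Finset.sum_filter, Finset.sum_const, card_compatible_states, nsmul_eq_mul, edgeWeight,
      Finset.prod_mul_distrib]
    push_cast
    ring
  have h5 : ∑ f, (∏ q, eps (f q)) * edgeWeight γ (upCount hγ hG f) =
      ∑ M ∈ Fintype.piFinset fun h : E × Bool => Finset.range (γ h.1 + 1),
        edgeWeight γ M * vertexWeight hγ hG M := by
    rw [← Finset.sum_fiberwise_of_maps_to (g := upCount hγ hG)
      (t := Fintype.piFinset fun h : E × Bool => Finset.range (γ h.1 + 1))]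
    · refine Finset.sum_congr rfl fun M _ => ?_
      rw [vertexWeight, Finset.mul_sum]
      refine Finset.sum_congr rfl fun f hf => ?_
      rw [(Finset.mem_filter.mp hf).2, mul_comm]
    · intro f _
      rw [Fintype.mem_piFinset]
      intro h
      rw [Finset.mem_range, Nat.lt_succ_iff]
      exact upCount_le hγ hG f h
  have hs : |s₁| = 1 := by
    rcases Int.units_eq_one_or (Equiv.Perm.sign (gluing hγ hG 1)) with h | h <;> simp [s₁, h]
  rw [h4, h5, abs_mul, abs_mul, hs, abs_pow]
  simp

/-- Cauchy's estimate for the generating polynomial. Since it is homogeneous of degree `γ h.1` in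
`(x h, y h)`, rotating `x` alone isolates the coefficient. The radii `√(M h)` and `√(γ h.1 - M h)`
have squares adding up to `γ h.1`, as `prod_norm_cross_pow_le` requires. -/
theorem abs_vertexWeight_mul_le (M : E × Bool → ℕ) (hM : ∀ h, M h ≤ γ h.1) :
    |(vertexWeight hγ hG M : ℝ)| *
      ∏ h : E × Bool, (√(M h) ^ M h * √((γ h.1 - M h : ℕ) : ℝ) ^ (γ h.1 - M h)) ≤
      ∏ v, vertexBound G γ v := by
  set p : E × Bool → ℝ := fun h => √(M h)
  set r : E × Bool → ℝ := fun h => √((γ h.1 - M h : ℕ) : ℝ)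
  have h1 := norm_sum_filter_le
    (fun f : G.VertexStrand γ → Bool => (∏ q, (eps (f q) : ℂ)) * ∏ h : E × Bool,
      ((p h : ℂ) ^ upCount hγ hG f h * (r h : ℂ) ^ (γ h.1 - upCount hγ hG f h)))
    (upCount hγ hG) M (∏ v, vertexBound G γ v) (fun z hz => by
      have h2 : ∀ f : G.VertexStrand γ → Bool, ((∏ q, (eps (f q) : ℂ)) * ∏ h : E × Bool,
          ((p h : ℂ) ^ upCount hγ hG f h * (r h : ℂ) ^ (γ h.1 - upCount hγ hG f h))) *
          ∏ h, z h ^ upCount hγ hG f h = (∏ q, (eps (f q) : ℂ)) * ∏ h : E × Bool,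
          ((p h * z h : ℂ) ^ upCount hγ hG f h * (r h : ℂ) ^ (γ h.1 - upCount hγ hG f h)) :=
        fun f => by
          rw [mul_assoc, ← Finset.prod_mul_distrib]
          congr 1
          refine Finset.prod_congr rfl fun h _ => ?_
          rw [mul_pow]; ring
      rw [Finset.sum_congr rfl fun f _ => h2 f,
        sum_eps_mul_prod hγ hG (fun h => p h * z h) (fun h => (r h : ℂ)), norm_prod]
      refine Finset.prod_le_prod (fun v _ => norm_nonneg _) fun v _ => ?_
      rw [norm_prod]
      refine le_trans (le_of_eq ?_) (prod_norm_cross_pow_le (G.corner γ v)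
        (fun k => (p (G.halfEdge (v, k)) * z (G.halfEdge (v, k)) : ℂ))
        (fun k => (r (G.halfEdge (v, k)) : ℂ)) ?_)
      · refine Finset.prod_congr rfl fun k _ => ?_
        rw [norm_pow, norm_sub_rev]
      · have h3 : ∀ k, ‖(p (G.halfEdge (v, k)) * z (G.halfEdge (v, k)) : ℂ)‖ ^ 2 +
            ‖(r (G.halfEdge (v, k)) : ℂ)‖ ^ 2 = (G.label γ v k : ℝ) := fun k => by
          rw [norm_mul, hz, mul_one, Complex.norm_real, Complex.norm_real, Real.norm_eq_abs,
            Real.norm_eq_abs, sq_abs, sq_abs, Real.sq_sqrt (by positivity),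
            Real.sq_sqrt (by positivity), ← Nat.cast_add, Nat.add_sub_cancel' (hM _)]
          rfl
        rw [Finset.sum_congr rfl fun k _ => h3 k]
        exact_mod_cast hγ.sum_label v)
  refine le_trans (le_of_eq ?_) h1
  have h4 : ∀ f ∈ Finset.univ.filter (fun f => upCount hγ hG f = M),
      (∏ q, (eps (f q) : ℂ)) * ∏ h : E × Bool,
      ((p h : ℂ) ^ upCount hγ hG f h * (r h : ℂ) ^ (γ h.1 - upCount hγ hG f h)) =
      (∏ q, (eps (f q) : ℂ)) * ∏ h : E × Bool,
      ((p h : ℂ) ^ M h * (r h : ℂ) ^ (γ h.1 - M h)) := fun f hf => by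
    rw [(Finset.mem_filter.mp hf).2]
  rw [Finset.sum_congr rfl h4, ← Finset.sum_mul, norm_mul]
  congr 1
  · rw [← Real.norm_eq_abs, ← Complex.norm_real, vertexWeight]
    push_cast
    rfl
  · rw [norm_prod]
    refine Finset.prod_congr rfl fun h _ => ?_
    rw [norm_mul, norm_pow, norm_pow, Complex.norm_real, Complex.norm_real, Real.norm_eq_abs,
      Real.norm_eq_abs, abs_of_nonneg (Real.sqrt_nonneg _), abs_of_nonneg (Real.sqrt_nonneg _)]

/-- Every term of the state sum has the same bound, because the factors depending on `M` cancel. One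
factor `γ h.1 + 1` comes from Stirling, the other from the number of values of `M h`. -/
theorem abs_penroseEval_le (hγ : G.Admissible γ) (hG : ∀ e, ¬ G.IsTrivialComponent e) :
    |(G.penroseEval γ : ℝ)| ≤ (∏ h : E × Bool, (Real.exp 1 * ((γ h.1 : ℝ) + 1) ^ 2)) *
      ∏ v, (vertexBound G γ v * Real.exp (-((∑ k, G.corner γ v k : ℕ) : ℝ))) := by
  -- The exponentials move from half-edges to vertices: half the sum of the labels at a vertex is
  -- the sum of its corners.
  have h0 : ∏ h : E × Bool, Real.exp (-(γ h.1 / 2 : ℝ)) =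
      ∏ v, Real.exp (-((∑ k, G.corner γ v k : ℕ) : ℝ)) := by
    rw [← (Equiv.ofBijective _ (halfEdge_bijective hG)).prod_comp, Fintype.prod_prod_type]
    refine Finset.prod_congr rfl fun v _ => ?_
    rw [← Real.exp_sum, Finset.sum_neg_distrib, ← Finset.sum_div]
    congr 2
    have : ∑ k, (G.label γ v k : ℝ) = 2 * ((∑ k, G.corner γ v k : ℕ) : ℝ) := by
      exact_mod_cast hγ.sum_label v
    rw [div_eq_iff two_ne_zero, mul_comm _ (2 : ℝ), ← this]
    rfl
  have h1 : |(G.penroseEval γ : ℝ)| =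
      |∑ M ∈ Fintype.piFinset fun h : E × Bool => Finset.range (γ h.1 + 1),
        (edgeWeight γ M : ℝ) * (vertexWeight hγ hG M : ℝ)| := by
    have := abs_penroseEval hγ hG
    exact_mod_cast this
  set C : ℝ := ∏ h : E × Bool, (Real.exp 1 * (γ h.1 + 1) * Real.exp (-(γ h.1 / 2 : ℝ)))
  have h2 : ∀ M ∈ Fintype.piFinset fun h : E × Bool => Finset.range (γ h.1 + 1),
      |(edgeWeight γ M : ℝ) * (vertexWeight hγ hG M : ℝ)| ≤ C * ∏ v, vertexBound G γ v := by
    intro M hM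
    have hM' : ∀ h, M h ≤ γ h.1 := fun h =>
      Nat.lt_succ_iff.mp (Finset.mem_range.mp (Fintype.mem_piFinset.mp hM h))
    have h3 := abs_edgeWeight_le M hM'
    rw [Finset.prod_mul_distrib] at h3
    rw [abs_mul]
    calc |(edgeWeight γ M : ℝ)| * |(vertexWeight hγ hG M : ℝ)|
        ≤ (C * ∏ h : E × Bool, (√(M h) ^ M h * √((γ h.1 - M h : ℕ) : ℝ) ^ (γ h.1 - M h))) *
          |(vertexWeight hγ hG M : ℝ)| := by gcongr
      _ = C * (|(vertexWeight hγ hG M : ℝ)| *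
          ∏ h : E × Bool, (√(M h) ^ M h * √((γ h.1 - M h : ℕ) : ℝ) ^ (γ h.1 - M h))) := by ring
      _ ≤ _ := mul_le_mul_of_nonneg_left (abs_vertexWeight_mul_le hγ hG M hM')
          (Finset.prod_nonneg fun h _ => by positivity)
  rw [h1]
  refine (Finset.abs_sum_le_sum_abs _ _).trans ((Finset.sum_le_card_nsmul _ _ _ h2).trans_eq ?_)
  rw [Fintype.card_piFinset, nsmul_eq_mul]
  simp only [C, ← h0, Finset.card_range, Finset.prod_mul_distrib, Finset.prod_pow]
  push_cast
  ring

theorem abs_standardEval_le (hγ : G.Admissible γ) (hG : ∀ e, ¬ G.IsTrivialComponent e) :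
    |G.standardEval γ| ≤ (∏ h : E × Bool, (Real.exp 1 * ((γ h.1 : ℝ) + 1) ^ 2)) *
      ∏ v, √(((∑ k, G.corner γ v k : ℕ) : ℝ) ^ (∑ k, G.corner γ v k) /
        ∏ k, (G.corner γ v k : ℝ) ^ G.corner γ v k) := by
  rw [standardEval, abs_mul, abs_of_nonneg (a := ∏ v, _)
    (Finset.prod_nonneg fun v _ => by positivity)]
  calc _ ≤ ((∏ h : E × Bool, (Real.exp 1 * ((γ h.1 : ℝ) + 1) ^ 2)) *
      ∏ v, (vertexBound G γ v * Real.exp (-((∑ k, G.corner γ v k : ℕ) : ℝ)))) *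
      ∏ v, ((Nat.factorial (G.corner γ v 0) * Nat.factorial (G.corner γ v 1) *
        Nat.factorial (G.corner γ v 2) : ℕ) : ℝ)⁻¹ :=
        mul_le_mul_of_nonneg_right (abs_penroseEval_le hγ hG)
          (Finset.prod_nonneg fun v _ => by positivity)
    _ ≤ _ := by
      rw [mul_assoc, ← Finset.prod_mul_distrib]
      refine mul_le_mul_of_nonneg_left ?_ (Finset.prod_nonneg fun h _ => by positivity)
      refine Finset.prod_le_prod (fun v _ => ?_) fun v _ => vertexBound_mul_le v
      have : 0 ≤ vertexBound G γ v := Real.sqrt_nonneg _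
      positivity

end CubicRibbonGraph

/-! ### Scaling the decoration -/

namespace CubicRibbonGraph

variable {V E : Type*} {G : CubicRibbonGraph V E} {γ : E → ℕ}

theorem label_mul (n : ℕ) (v : V) (k : Fin 3) :
    G.label (fun e => n * γ e) v k = n * G.label γ v k := rfl

theorem Admissible.mul (hγ : G.Admissible γ) (n : ℕ) : G.Admissible (fun e => n * γ e) := by
  intro v
  obtain ⟨h1, h2, h3⟩ := hγ v
  simp only [label_mul]
  refine ⟨?_, ?_, ?_⟩
  · rw [← mul_add, ← mul_add]
    exact h1.mul_left n
  · push_cast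
    rw [← mul_sub, abs_mul, Nat.abs_cast]
    exact mul_le_mul_of_nonneg_left h2 (by positivity)
  · push_cast
    rw [← mul_add]
    exact mul_le_mul_of_nonneg_left h3 (by positivity)

theorem Admissible.corner_mul (hγ : G.Admissible γ) (n : ℕ) (v : V) (k : Fin 3) :
    G.corner (fun e => n * γ e) v k = n * G.corner γ v k := by
  have h1 := hγ.two_mul_corner v k
  have h2 := (hγ.mul n).two_mul_corner v k
  simp only [label_mul] at h2
  have h3 : n * (2 * G.corner γ v k + G.label γ v (k + 2)) =
      n * (G.label γ v k + G.label γ v (k + 1)) := by rw [h1]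
  have : 2 * G.corner (fun e => n * γ e) v k = 2 * (n * G.corner γ v k) := by
    linarith
  omega

theorem Admissible.spinBeta_label (hγ : G.Admissible γ) (v : V) :
    spinBeta (G.label γ v 0) (G.label γ v 1) (G.label γ v 2) =
      ((∑ k, G.corner γ v k : ℕ) : ℝ) ^ (∑ k, G.corner γ v k) /
        ∏ k, (G.corner γ v k : ℝ) ^ G.corner γ v k := by
  have h0 := hγ.corner_add_corner v 0
  have h1 := hγ.corner_add_corner v 1
  have h2 := hγ.corner_add_corner v 2
  simp only [Fin.reduceAdd, zero_add] at h0 h1 h2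
  rw [← h0, ← h1, ← h2, spinBeta]
  push_cast
  set c0 := G.corner γ v 0
  set c1 := G.corner γ v 1
  set c2 := G.corner γ v 2
  have e0 : ((c0 : ℝ) + c2 + (c1 + c0) + (c2 + c1)) / 2 = ((c0 + c1 + c2 : ℕ) : ℝ) := by
    push_cast; ring
  have e1 : ((c0 : ℝ) + c2 + (c1 + c0) - (c2 + c1)) / 2 = c0 := by ring
  have e2 : ((c0 : ℝ) + c2 + (c2 + c1) - (c1 + c0)) / 2 = c2 := by ring
  have e3 : ((c1 : ℝ) + c0 + (c2 + c1) - (c0 + c2)) / 2 = c1 := by ring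
  rw [e0, e1, e2, e3]
  simp only [Real.rpow_natCast, Fin.sum_univ_three, Fin.prod_univ_three]
  push_cast
  ring

/-- Numerator and denominator have the same total exponent, so the powers of `n` cancel: `β` grows
exactly geometrically under scaling. -/
theorem mul_pow_mul_div_prod {ι : Type*} [Fintype ι] (c : ι → ℕ) (n : ℕ) :
    ((∑ i, n * c i : ℕ) : ℝ) ^ (∑ i, n * c i) / ∏ i, ((n * c i : ℕ) : ℝ) ^ (n * c i) =
      (((∑ i, c i : ℕ) : ℝ) ^ (∑ i, c i) / ∏ i, (c i : ℝ) ^ c i) ^ n := by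
  rw [← Finset.mul_sum]
  set J := ∑ i, c i with hJ
  rcases Nat.eq_zero_or_pos n with rfl | hn
  · simp
  have h1 : ∏ i, ((n * c i : ℕ) : ℝ) ^ (n * c i) =
      (n : ℝ) ^ (n * J) * (∏ i, (c i : ℝ) ^ c i) ^ n := by
    rw [hJ, Finset.mul_sum, ← Finset.prod_pow_eq_pow_sum, ← Finset.prod_pow,
      ← Finset.prod_mul_distrib]
    refine Finset.prod_congr rfl fun i _ => ?_
    rw [Nat.cast_mul, mul_pow, ← pow_mul, mul_comm (c i) n]
  have hn' : (n : ℝ) ^ (n * J) ≠ 0 := by positivity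
  rw [h1, Nat.cast_mul, mul_pow, mul_div_mul_left _ _ hn', div_pow, ← pow_mul, mul_comm n J]

theorem abs_standardEval_mul_le [Fintype V] [Fintype E] [DecidableEq E] (hγ : G.Admissible γ)
    (hG : ∀ e, ¬ G.IsTrivialComponent e) (n : ℕ) :
    |G.standardEval (fun e => n * γ e)| ≤
      (∏ h : E × Bool, (Real.exp 1 * ((γ h.1 : ℝ) + 1) ^ 2)) *
        (n + 1 : ℝ) ^ (2 * Fintype.card (E × Bool)) *
        (∏ v, √(spinBeta (G.label γ v 0) (G.label γ v 1) (G.label γ v 2))) ^ n := by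
  classical
  refine (abs_standardEval_le (hγ.mul n) hG).trans ?_
  have h1 : ∏ v, √(((∑ k, G.corner (fun e => n * γ e) v k : ℕ) : ℝ) ^
      (∑ k, G.corner (fun e => n * γ e) v k) /
        ∏ k, (G.corner (fun e => n * γ e) v k : ℝ) ^ G.corner (fun e => n * γ e) v k) =
      (∏ v, √(spinBeta (G.label γ v 0) (G.label γ v 1) (G.label γ v 2))) ^ n := by
    rw [← Finset.prod_pow]
    refine Finset.prod_congr rfl fun v _ => ?_
    simp only [hγ.corner_mul, mul_pow_mul_div_prod]
    rw [hγ.spinBeta_label]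
    refine (Real.sqrt_eq_iff_eq_sq (pow_nonneg ?_ _) (by positivity)).mpr ?_
    · exact div_nonneg (by positivity) (Finset.prod_nonneg fun k _ => by positivity)
    · rw [← pow_mul, mul_comm, pow_mul, Real.sq_sqrt]
      exact div_nonneg (by positivity) (Finset.prod_nonneg fun k _ => by positivity)
  rw [h1]
  refine mul_le_mul_of_nonneg_right ?_
    (pow_nonneg (Finset.prod_nonneg fun v _ => Real.sqrt_nonneg _) _)
  rw [pow_mul, ← Finset.card_univ, ← Finset.prod_const, ← Finset.prod_mul_distrib]
  refine Finset.prod_le_prod (fun h _ => by positivity) fun h _ => ?_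
  rw [mul_assoc, ← mul_pow]
  refine mul_le_mul_of_nonneg_left (pow_le_pow_left₀ (by positivity) ?_ 2) (by positivity)
  push_cast
  -- This is `n * γ + 1 ≤ (γ + 1) * (n + 1)`.
  nlinarith [Nat.cast_nonneg (α := ℝ) (γ h.1), Nat.cast_nonneg (α := ℝ) n]

end CubicRibbonGraph

/-! ### Radius of convergence and conclusion -/

theorem inv_radius_ofScalars_le {a : ℕ → ℝ} {C B : ℝ} {D : ℕ} (hC : 0 ≤ C) (hB : 0 < B)
    (h : ∀ n : ℕ, |a n| ≤ C * (n + 1 : ℝ) ^ D * B ^ n) :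
    (FormalMultilinearSeries.ofScalars ℝ a).radius⁻¹ ≤ ENNReal.ofReal B := by
  rw [ENNReal.inv_le_iff_inv_le]
  refine ENNReal.le_of_forall_nnreal_lt fun r hr => ?_
  rcases eq_or_ne r 0 with rfl | hr0
  · simp
  have hr0' : (0 : ℝ) < r := lt_of_le_of_ne r.2 fun h => hr0 (NNReal.eq h.symm)
  have hq : (r : ℝ) * B < 1 := by
    rw [← ENNReal.ofReal_inv_of_pos hB, ← ENNReal.ofReal_coe_nnreal,
      ENNReal.ofReal_lt_ofReal_iff (by positivity), lt_inv_comm₀ hr0' hB, lt_inv_comm₀ hB hr0'] at hr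
    rw [← lt_div_iff₀ hB, one_div]
    exact hr
  set q : ℝ := r * B
  have hq0 : 0 < q := by positivity
  obtain ⟨K, hK⟩ := (tendsto_pow_const_mul_const_pow_of_abs_lt_one D
    (r := q) (by rwa [abs_of_pos hq0])).bddAbove_range
  -- `K` bounds `m ^ D * q ^ m`; it is used at `m = n + 1`, whence the division by `q`.
  refine FormalMultilinearSeries.le_radius_of_bound _ (C * (K / q)) fun n => ?_
  rw [FormalMultilinearSeries.ofScalars_norm, Real.norm_eq_abs]
  have hKn : ((n + 1 : ℕ) : ℝ) ^ D * q ^ (n + 1) ≤ K := hK ⟨n + 1, rfl⟩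
  calc |a n| * (r : ℝ) ^ n ≤ C * (n + 1 : ℝ) ^ D * B ^ n * (r : ℝ) ^ n := by
        gcongr
        exact h n
    _ = C * (((n + 1 : ℕ) : ℝ) ^ D * q ^ n) := by
        simp only [q]; push_cast; rw [mul_pow]; ring
    _ ≤ C * (K / q) := by
        refine mul_le_mul_of_nonneg_left ?_ hC
        rw [le_div_iff₀ hq0, mul_assoc, ← pow_succ]
        exact hKn

theorem mainTheorem3 {V E : Type*} [Fintype V] [Fintype E] [DecidableEq E]
    (G : CubicRibbonGraph V E) (γ : E → ℕ) (hγ : G.Admissible γ)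
    (hG : ∀ e, ¬ G.IsTrivialComponent e) :
    G.spectralRadius γ ≤ ENNReal.ofReal
      (∏ v, Real.sqrt (spinBeta (G.label γ v 0) (G.label γ v 1) (G.label γ v 2))) := by
  refine inv_radius_ofScalars_le (Finset.prod_nonneg fun h _ => by positivity) ?_
    (G.abs_standardEval_mul_le hγ hG)
  -- The convention `0 ^ 0 = 1` keeps `β` positive even when corners vanish.
  have hpos : ∀ m : ℕ, (0 : ℝ) < (m : ℝ) ^ m := fun m => by
    rcases Nat.eq_zero_or_pos m with rfl | h
    · simp
    · positivity
  refine Finset.prod_pos fun v _ => Real.sqrt_pos.mpr ?_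
  rw [hγ.spinBeta_label]
  exact div_pos (hpos _) (Finset.prod_pos fun k _ => hpos _)
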